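/- Let $\mathbb{S}^3\subset\mathbb{R}^4$ be the round unit sphere with Levi-Civita connection $\nabla$ and Riemannian volume $d\nu$, and let $\mathbb{S}^3(r)$ be the sphere of radius $r$ about the origin. Let $K\subset\mathbb{S}^3$ be a compact connected smooth $3$-dimensional submanifold with (possibly empty) boundary $\partial K$ and outward unit conormal $\eta$ (the unit vector field along $\partial K$ that is tangent to $\mathbb{S}^3$, normal to $\partial K$ and points out of $K$). For a smooth unit tangent vector field $X$ on $\mathbb{S}^3$ put $$\mathrm{vol}(X)=\int_K\sqrt{\det\left(\mathrm{Id}+(\nabla X)^{T}\nabla X\right)}\,d\nu,\qquad \mathcal{E}(X)=\frac32\,\mathrm{vol}(K)+\frac12\int_K\|\nabla X\|^2\,d\nu,$$ where $\|\nabla X\|^2=\mathrm{tr}\left((\nabla X)^T\nabla X\right)$. Let $v$ be a smooth unit tangent vector field on $\mathbb{S}^3$ and let $t>0$ be such that the map $\varphi_t:\mathbb{S}^3\to\mathbb{S}^3(\sqrt{1+t^2})$, $\varphi_t(x)=x+t\,v(x)$, is a diffeomorphism. Suppose that 1. $\displaystyle\int_{\partial K}\langle v,\eta\rangle=0$ (integral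 with respect to the area measure of $\partial K$), and 2. $\displaystyle\frac{\mathrm{vol}(\varphi_t(K))}{\mathrm{vol}(\mathbb{S}^3(\sqrt{1+t^2}))}\ge\frac{\mathrm{vol}(K)}{\mathrm{vol}(\mathbb{S}^3)}$. Let $H$ be any Hopf vector field, that is, $H(x)=Jx$ for a linear isometry $J$ of $\mathbb{R}^4$ with $J^2=-\mathrm{Id}$. Then $$\mathrm{vol}(v)\ge\mathrm{vol}(H)=2\,\mathrm{vol}(K)\qquad\text{and}\qquad\mathcal{E}(v)\ge\mathcal{E}(H).$$ -/

import Mathlib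

open MeasureTheory Metric Set
open scoped Manifold ContDiff InnerProductSpace RealInnerProductSpace

noncomputable section

namespace SphereField

/-- Euclidean four-space. -/
abbrev E4 : Type := EuclideanSpace ℝ (Fin 4)

/-- The round unit sphere `S³ ⊂ ℝ⁴`, with Mathlib's smooth structure. -/
abbrev S3 : Type := sphere (0 : E4) 1

/-- The Riemannian volume measure of the unit sphere `S³`. -/
def vol3 : Measure S3 := (volume : Measure E4).toSphere

/-- The Riemannian volume of a subset `A` of the sphere `S³(r)` of radius `r > 0` about the origin:
the homothety `x ↦ r x` from `S³` onto `S³(r)` multiplies volumes by `r ^ 3`. -/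
def radiusVol (r : ℝ) (A : Set E4) : ℝ := r ^ 3 * vol3.real {x : S3 | r • (x : E4) ∈ A}

/-- `K` is a compact connected smooth 3-dimensional submanifold with (possibly empty) boundary of
`S³`: near each of its topological boundary points, `K` is a closed half-space in some smooth chart
of `S³` (near its other points, `K` is open in `S³`). The manifold boundary `∂K` is `frontier K`. -/
structure IsDomain3 (K : Set S3) : Prop where
  isCompact : IsCompact K
  isConnected : IsConnected K
  halfSpaceChart : ∀ p ∈ frontier K, ∃ e ∈ IsManifold.maximalAtlas (𝓡 3) ∞ S3,
    p ∈ e.source ∧ ∀ y ∈ e.source, y ∈ K ↔ 0 ≤ e y 0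

/-- `v` is a smooth unit tangent vector field on `S³`. -/
structure IsUnitField (v : S3 → E4) : Prop where
  smooth : ContMDiff (𝓡 3) 𝓘(ℝ, E4) ∞ v
  tangent : ∀ x : S3, ⟪(x : E4), v x⟫ = 0
  unit : ∀ x : S3, ‖v x‖ = 1

/-- The tangent space `T_x S³ = x^⊥`, as a subspace of `ℝ⁴` with the induced inner product. -/
abbrev Tan (x : S3) : Submodule ℝ E4 := (ℝ ∙ (x : E4))ᗮ

/-- The extension `y ↦ v (y / ‖y‖)` of a field on `S³` to `ℝ⁴ \ {0}`. -/
def radialExt (v : S3 → E4) (y : E4) : E4 :=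
  if h : y = 0 then 0 else v ⟨‖y‖⁻¹ • y, by simp [norm_smul, h]⟩

/-- The endomorphism `w ↦ ∇_w v` of `T_x S³` given by the Levi-Civita connection `∇` of `S³`: the
tangential part of the derivative in `ℝ⁴`. -/
def covDeriv (v : S3 → E4) (x : S3) : Tan x →ₗ[ℝ] Tan x :=
  ((Tan x).orthogonalProjectionOnto ∘L fderiv ℝ (radialExt v) (x : E4) ∘L (Tan x).subtypeL :
    Tan x →L[ℝ] Tan x)

/-- `vol(v) = ∫_K √det(Id + (∇v)ᵀ ∇v)`. -/
def fieldVol (K : Set S3) (v : S3 → E4) : ℝ :=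
  ∫ x in K, √(LinearMap.det
    (LinearMap.id + LinearMap.adjoint (covDeriv v x) ∘ₗ covDeriv v x)) ∂vol3

/-- `E(v) = (3/2) vol(K) + (1/2) ∫_K ‖∇v‖²`, where `‖A‖² = tr(Aᵀ A)`. -/
def energy (K : Set S3) (v : S3 → E4) : ℝ :=
  3 / 2 * vol3.real K + 1 / 2 * ∫ x in K,
    LinearMap.trace ℝ (Tan x) (LinearMap.adjoint (covDeriv v x) ∘ₗ covDeriv v x) ∂vol3

/-- The map `φ_t(x) = x + t v(x)`. -/
def flowMap (v : S3 → E4) (t : ℝ) (x : S3) : E4 := (x : E4) + t • v x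

/-- `f` is a diffeomorphism from `S³` onto the sphere `S³(r)`, the latter being identified with
`S³` by the homothety `x ↦ r x`. -/
def IsDiffeoOntoSphere (f : S3 → E4) (r : ℝ) : Prop :=
  ∃ ψ : S3 ≃ₘ^∞⟮𝓡 3, 𝓡 3⟯ S3, ∀ x, f x = r • (ψ x : E4)

/-- `w` is the outward unit conormal of `K` at the boundary point `p`: a unit vector tangent to
`S³` that makes no acute angle with a tangent vector pointing into `K`. These tangent vectors form
a closed half-space of `T_p S³` bounded by `T_p ∂K`, so `w` is orthogonal to `T_p ∂K`. -/
structure IsOutwardConormal (K : Set S3) (p : S3) (w : E4) : Prop where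
  unit : ‖w‖ = 1
  tangent : ⟪(p : E4), w⟫ = 0
  outward : ∀ u ∈ posTangentConeAt ((↑) '' K : Set E4) (p : E4), ⟪w, u⟫ ≤ 0

/-- `H` is a Hopf vector field: `H(x) = J x` for an orthogonal complex structure `J` of `ℝ⁴`, so
that its integral curves are the fibres of a Hopf fibration. -/
def IsHopfField (H : S3 → E4) : Prop :=
  ∃ J : E4 →ₗᵢ[ℝ] E4, (∀ x, J (J x) = -x) ∧ ∀ x : S3, H x = J x

end SphereField

end

open Filter Topology

namespace SphereField

/-! At each `x` choose an orthonormal frame of `ℝ⁴` starting with `x` and `v x`. Let `s₂` be the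
determinant of the 2×2 block of `∇v` on the plane orthogonal to both. Since `|v| = 1`, the image of
`∇v` lies in this plane. Hence `det(Id + (∇v)ᵀ∇v)` is a sum of squares of minors and `‖∇v‖²` is a
sum of squares of entries. This gives the densities the lower bounds `1 + |s₂|` and `2|s₂|`
(`IsUnitField.exists_pointwise`). A Hopf field rotates the plane by a right angle, and both its
densities equal 2 (`IsHopfField.pointwise`). It remains to prove `∫_K |s₂| ≥ vol(K)`.

This comes from the Jacobian of `φ_t`. Rescaled to a self-map of the unit sphere, it is `(1 + t div
v + t² s₂) / (1 + t²)`. For a diffeomorphism it never vanishes, so it has constant sign on the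
connected sphere. Then `vol(φ_t(K))`, after rescaling, is the absolute value of an integral that is
affine in `∫ div v` and `∫ s₂`. If `∫_K div v = 0`, the volume hypothesis yields the bound
(`IsUnitField.vol_le_integral`, `main_of_integral_sdiv`).

The vanishing of `∫_K div v` is the divergence theorem on `K`, with boundary area taken as Hausdorff
measure (`IsDomain3.integral_sdiv_eq_flux`). On the whole sphere, divergences integrate to zero by
passing to compactly supported fields on `ℝ⁴` (`integral_sdiv`). For a domain with local defining
function `h`, the indicator is smoothed to `ramp (c * h)`. Integrating by parts leaves a boundary
layer that concentrates on `h = 0` as `c → ∞`. To identify the limit with an area, the layer and the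
boundary are read in a chart with distortion close to 1 (`exists_isAlmostIsometric`). This costs a
relative error `ε` near each point. A partition of unity adds the errors to at most `8 ε area(∂K)`,
and `ε → 0`.

Fields on the sphere are handled throughout by homogeneous extension to `ℝ⁴ \ {0}`: degree zero for
derivatives, degree one for maps and volumes. -/

instance : Fact (Module.finrank ℝ E4 = 3 + 1) := ⟨finrank_euclideanSpace_fin⟩

/-! ### The radial projection onto the sphere and homogeneous extensions -/

/-- A base point of the sphere, the value of `dir` at the origin. -/
noncomputable def basePoint : S3 := ⟨EuclideanSpace.single 0 1, by simp⟩

/-- The radial projection `y ↦ y / ‖y‖` of `ℝ⁴ \ {0}` onto `S³`. -/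
noncomputable def dir (y : E4) : S3 :=
  if h : y = 0 then basePoint else ⟨‖y‖⁻¹ • y, by simp [norm_smul, h]⟩

lemma coe_dir {y : E4} (hy : y ≠ 0) : (dir y : E4) = ‖y‖⁻¹ • y := by simp [dir, hy]

@[simp] lemma norm_coe_S3 (x : S3) : ‖(x : E4)‖ = 1 := norm_eq_of_mem_sphere x

lemma coe_S3_ne_zero (x : S3) : (x : E4) ≠ 0 := ne_zero_of_mem_unit_sphere x

lemma inner_self_S3 (x : S3) : ⟪(x : E4), (x : E4)⟫ = 1 := by simp

@[simp] lemma dir_coe (x : S3) : dir (x : E4) = x := by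
  ext1; simp [coe_dir (coe_S3_ne_zero x)]

lemma dir_smul {r : ℝ} (hr : 0 < r) (y : E4) : dir (r • y) = dir y := by
  by_cases hy : y = 0
  · simp [hy]
  · ext1
    rw [coe_dir hy, coe_dir (smul_ne_zero hr.ne' hy), norm_smul, smul_smul,
      Real.norm_of_nonneg hr.le]
    congr 1
    have := norm_ne_zero_iff.2 hy
    field_simp

lemma norm_smul_dir {y : E4} (hy : y ≠ 0) : ‖y‖ • (dir y : E4) = y := by
  rw [coe_dir hy, smul_smul, mul_inv_cancel₀ (norm_ne_zero_iff.2 hy), one_smul]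

lemma radialExt_eq (v : S3 → E4) {y : E4} (hy : y ≠ 0) : radialExt v y = v (dir y) := by
  simp [radialExt, dir, hy]

lemma radialExt_eventuallyEq (v : S3 → E4) (x : S3) : radialExt v =ᶠ[𝓝 (x : E4)] v ∘ dir := by
  filter_upwards [isOpen_ne.mem_nhds (coe_S3_ne_zero x)] with y hy using radialExt_eq v hy

/-- Restricting the codomain to the sphere requires a map that is smooth on a whole manifold, so the
argument runs on the open submanifold `ℝ⁴ \ {0}`. -/
lemma contMDiffAt_dir {y : E4} (hy : y ≠ 0) : ContMDiffAt 𝓘(ℝ, E4) (𝓡 3) ∞ dir y := by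
  let O : TopologicalSpace.Opens E4 := ⟨{0}ᶜ, isOpen_compl_singleton⟩
  have hO : ∀ z : O, (z : E4) ≠ 0 := fun z => z.2
  have h1 : ContMDiff 𝓘(ℝ, E4) 𝓘(ℝ, E4) ∞ (fun z : O => ‖(z : E4)‖⁻¹ • (z : E4)) := by
    intro z
    have h2 : ContDiffAt ℝ ∞ (fun z : E4 => ‖z‖⁻¹ • z) (z : E4) :=
      ((contDiffAt_norm ℝ (hO z)).inv (norm_ne_zero_iff.2 (hO z))).smul contDiffAt_id
    exact (contMDiffAt_subtype_iff (U := O) (f := fun z : E4 => ‖z‖⁻¹ • z)).2 h2.contMDiffAt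
  have h3 : ∀ z : O, ‖(z : E4)‖⁻¹ • (z : E4) ∈ sphere (0 : E4) 1 := fun z => by
    simp [norm_smul, hO z]
  have h4 := ContMDiff.codRestrict_sphere (n := 3) h1 h3
  have h5 : Set.codRestrict _ _ h3 = fun z : O => dir (z : E4) := by
    ext1 z; ext1; simp [coe_dir (hO z)]
  rw [h5] at h4
  exact (contMDiffAt_subtype_iff (U := O) (f := dir) (x := ⟨y, hy⟩)).1 (h4 ⟨y, hy⟩)

variable {F : Type*} [NormedAddCommGroup F] [NormedSpace ℝ F]

lemma contDiffAt_comp_dir {f : S3 → F} (hf : ContMDiff (𝓡 3) 𝓘(ℝ, F) ∞ f) {y : E4} (hy : y ≠ 0) :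
    ContDiffAt ℝ ∞ (f ∘ dir) y :=
  ((hf _).comp y (contMDiffAt_dir hy)).contDiffAt

lemma differentiableAt_comp_dir {f : S3 → F} (hf : ContMDiff (𝓡 3) 𝓘(ℝ, F) ∞ f) {y : E4}
    (hy : y ≠ 0) : DifferentiableAt ℝ (f ∘ dir) y :=
  (contDiffAt_comp_dir hf hy).differentiableAt (by simp)

lemma continuousAt_dir {y : E4} (hy : y ≠ 0) : ContinuousAt dir y :=
  (contMDiffAt_dir hy).continuousAt

/-- The derivative at a point of the sphere of the degree zero homogeneous extension. -/
noncomputable def sderiv (f : S3 → F) (x : S3) : E4 →L[ℝ] F := fderiv ℝ (f ∘ dir) (x : E4)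

lemma continuous_sderiv {f : S3 → F} (hf : ContMDiff (𝓡 3) 𝓘(ℝ, F) ∞ f) :
    Continuous (sderiv f) := by
  rw [continuous_iff_continuousAt]
  intro x
  have h : ContinuousAt (fderiv ℝ (f ∘ dir)) (x : E4) :=
    ((contDiffAt_comp_dir hf (coe_S3_ne_zero x)).fderiv_right (m := 0) (by simp)).continuousAt
  exact h.comp (f := fun x : S3 => (x : E4)) continuous_subtype_val.continuousAt

lemma hasFDerivAt_sderiv {f : S3 → F} (hf : ContMDiff (𝓡 3) 𝓘(ℝ, F) ∞ f) (x : S3) :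
    HasFDerivAt (f ∘ dir) (sderiv f x) (x : E4) :=
  (differentiableAt_comp_dir hf (coe_S3_ne_zero x)).hasFDerivAt

/-- The derivative of a degree zero homogeneous function has degree `-1`. -/
lemma hasFDerivAt_comp_dir {f : S3 → F} (hf : ContMDiff (𝓡 3) 𝓘(ℝ, F) ∞ f) {y : E4} (hy : y ≠ 0) :
    HasFDerivAt (f ∘ dir) (‖y‖⁻¹ • sderiv f (dir y)) y := by
  have hpos : 0 < ‖y‖⁻¹ := inv_pos.2 (norm_pos_iff.2 hy)
  have h1 : HasFDerivAt (fun z : E4 => ‖y‖⁻¹ • z) (‖y‖⁻¹ • ContinuousLinearMap.id ℝ E4) y :=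
    (hasFDerivAt_id (𝕜 := ℝ) y).fun_const_smul _
  have h2 := hasFDerivAt_sderiv hf (dir y)
  rw [coe_dir hy] at h2
  have h3 := h2.comp y h1
  have h4 : (f ∘ dir) ∘ (fun z : E4 => ‖y‖⁻¹ • z) = f ∘ dir := by
    ext z; simp [dir_smul hpos]
  have h5 : (sderiv f (dir y)).comp (‖y‖⁻¹ • ContinuousLinearMap.id ℝ E4) =
      ‖y‖⁻¹ • sderiv f (dir y) := by ext u; simp
  rwa [h4, h5] at h3

/-- The degree zero extension is constant along the ray through `x`. -/
lemma sderiv_self {f : S3 → F} (hf : ContMDiff (𝓡 3) 𝓘(ℝ, F) ∞ f) (x : S3) :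
    sderiv f x (x : E4) = 0 := by
  have h1 : HasDerivAt (fun r : ℝ => r • (x : E4)) (x : E4) 1 := by
    simpa using (hasDerivAt_id (1 : ℝ)).smul_const (x : E4)
  have h2 : HasFDerivAt (f ∘ dir) (sderiv f x) ((1 : ℝ) • (x : E4)) := by
    simpa using hasFDerivAt_sderiv hf x
  have h3 := h2.comp_hasDerivAt 1 h1
  have h4 : (f ∘ dir) ∘ (fun r : ℝ => r • (x : E4)) =ᶠ[𝓝 1] fun _ => f x := by
    filter_upwards [lt_mem_nhds (zero_lt_one' ℝ)] with r hr
    simp [dir_smul hr]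
  exact h3.unique ((hasDerivAt_const (1 : ℝ) (f x)).congr_of_eventuallyEq h4)

lemma fderiv_radialExt (v : S3 → E4) (x : S3) : fderiv ℝ (radialExt v) (x : E4) = sderiv v x :=
  (radialExt_eventuallyEq v x).fderiv_eq

lemma contMDiff_coe : ContMDiff (𝓡 3) 𝓘(ℝ, E4) ∞ (fun x : S3 => (x : E4)) :=
  contMDiff_coe_sphere

lemma sderiv_smul {φ : S3 → ℝ} {v : S3 → F} (hφ : ContMDiff (𝓡 3) 𝓘(ℝ, ℝ) ∞ φ)
    (hv : ContMDiff (𝓡 3) 𝓘(ℝ, F) ∞ v) (x : S3) :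
    sderiv (fun x => φ x • v x) x = φ x • sderiv v x + (sderiv φ x).smulRight (v x) := by
  have := (hasFDerivAt_sderiv hφ x).smul (hasFDerivAt_sderiv hv x)
  rw [sderiv, show (fun x => φ x • v x) ∘ dir = φ ∘ dir • v ∘ dir from rfl]
  simpa using this.fderiv

/-! ### Pointwise linear algebra of the covariant derivative -/

/-- Two orthonormal vectors are the first two vectors of an orthonormal basis. -/
lemma exists_orthonormalBasis {x w : E4} (hx : ‖x‖ = 1) (hw : ‖w‖ = 1) (hxw : ⟪x, w⟫ = 0) :
    ∃ b : OrthonormalBasis (Fin 4) ℝ E4, b 0 = x ∧ b 1 = w := by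
  have hon : Orthonormal ℝ (({0, 1} : Set (Fin 4)).domRestrict ![x, w, 0, 0]) := by
    rw [orthonormal_iff_ite]
    rintro ⟨i, hi⟩ ⟨j, hj⟩
    simp only [mem_insert_iff, mem_singleton_iff] at hi hj
    have hwx : ⟪w, x⟫ = 0 := by rw [real_inner_comm, hxw]
    obtain rfl | rfl := hi <;> obtain rfl | rfl := hj <;> simp [hx, hw, hxw, hwx]
  obtain ⟨b, hb⟩ := hon.exists_orthonormalBasis_extension_of_card_eq (by simp)
  exact ⟨b, by simpa using hb 0 (by simp), by simpa using hb 1 (by simp)⟩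

lemma exists_orthonormalBasis_zero (x : S3) :
    ∃ b : OrthonormalBasis (Fin 4) ℝ E4, b 0 = x := by
  have hon : Orthonormal ℝ (({0} : Set (Fin 4)).domRestrict fun _ => (x : E4)) := by
    rw [orthonormal_iff_ite]
    rintro ⟨i, hi⟩ ⟨j, hj⟩
    simp only [mem_singleton_iff] at hi hj
    subst hi hj
    simp
  obtain ⟨b, hb⟩ := hon.exists_orthonormalBasis_extension_of_card_eq (by simp)
  exact ⟨b, by simpa using hb 0 (by simp)⟩

lemma mem_Tan {x : S3} {u : E4} : u ∈ Tan x ↔ ⟪(x : E4), u⟫ = 0 :=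
  Submodule.mem_orthogonal_singleton_iff_inner_right

lemma finrank_Tan (x : S3) : Module.finrank ℝ (Tan x) = 3 :=
  Submodule.finrank_orthogonal_span_singleton (coe_S3_ne_zero x)

/-- The last three vectors of an orthonormal basis that starts with `x` form an orthonormal basis
of the tangent space at `x`. -/
lemma exists_tanBasis {x : S3} (b : OrthonormalBasis (Fin 4) ℝ E4) (hb : b 0 = x) :
    ∃ c : OrthonormalBasis (Fin 3) ℝ (Tan x), ∀ i, (c i : E4) = b i.succ := by
  have hmem : ∀ i : Fin 3, b i.succ ∈ Tan x := fun i => by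
    rw [mem_Tan, ← hb, b.inner_eq_zero (Fin.succ_ne_zero i).symm]
  have hon : Orthonormal ℝ (fun i : Fin 3 => (⟨b i.succ, hmem i⟩ : Tan x)) := by
    rw [orthonormal_iff_ite]
    intro i j
    simp [b.inner_eq_ite]
  obtain ⟨c, hc⟩ := Orthonormal.exists_orthonormalBasis_extension_of_card_eq
    (𝕜 := ℝ) (ι := Fin 3) (by simpa using finrank_Tan x)
    (v := fun i : Fin 3 => (⟨b i.succ, hmem i⟩ : Tan x)) (s := univ)
    (hon.comp _ Subtype.val_injective)
  exact ⟨c, fun i => by rw [hc i (mem_univ i)]⟩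

lemma det_eq_det_inner {ι V : Type*} [Fintype ι] [DecidableEq ι] [NormedAddCommGroup V]
    [InnerProductSpace ℝ V] (b : OrthonormalBasis ι ℝ V) (L : V →ₗ[ℝ] V) :
    LinearMap.det L = Matrix.det (Matrix.of fun i j => ⟪b i, L (b j)⟫) := by
  rw [← LinearMap.det_toMatrix b.toBasis]
  congr 1
  ext i j
  simp [LinearMap.toMatrix_apply, b.repr_apply_apply]

lemma inner_id_add_adjoint_comp {V : Type*} [NormedAddCommGroup V]
    [InnerProductSpace ℝ V] [FiniteDimensional ℝ V] (A : V →ₗ[ℝ] V) (u w : V) :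
    ⟪u, (LinearMap.id + LinearMap.adjoint A ∘ₗ A : V →ₗ[ℝ] V) w⟫ = ⟪u, w⟫ + ⟪A u, A w⟫ := by
  simp [inner_add_right, LinearMap.adjoint_inner_right]

/-- The extension of the covariant derivative to an endomorphism of `ℝ⁴` that kills `x`. -/
noncomputable def ambientCov (v : S3 → E4) (x : S3) : E4 →L[ℝ] E4 :=
  sderiv v x - ((innerSL ℝ (x : E4)).comp (sderiv v x)).smulRight (x : E4)

lemma ambientCov_apply (v : S3 → E4) (x : S3) (u : E4) :
    ambientCov v x u = sderiv v x u - ⟪(x : E4), sderiv v x u⟫ • (x : E4) := by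
  simp [ambientCov]

lemma coe_covDeriv (v : S3 → E4) (x : S3) (u : Tan x) :
    (covDeriv v x u : E4) = ambientCov v x u := by
  have : (covDeriv v x u : E4) = (Tan x).starProjection (sderiv v x u) := by
    simp [covDeriv, fderiv_radialExt]
  rw [this, ambientCov_apply, Submodule.starProjection_orthogonal_val,
    Submodule.starProjection_unit_singleton ℝ (norm_coe_S3 x)]

lemma continuous_ambientCov {v : S3 → E4} (hv : ContMDiff (𝓡 3) 𝓘(ℝ, E4) ∞ v) :
    Continuous (ambientCov v) := by
  have h1 := continuous_sderiv hv
  have h2 : Continuous fun x : S3 => (x : E4) := continuous_subtype_val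
  have h3 : Continuous fun x : S3 => innerSL ℝ (x : E4) := (innerSL ℝ).continuous.comp h2
  have h4 : Continuous fun x : S3 => (innerSL ℝ (x : E4)).comp (sderiv v x) := h3.clm_comp h1
  have h5 : Continuous fun x : S3 =>
      ContinuousLinearMap.smulRightL ℝ E4 E4 ((innerSL ℝ (x : E4)).comp (sderiv v x)) (x : E4) :=
    ((ContinuousLinearMap.smulRightL ℝ E4 E4).continuous.comp h4).clm_apply h2
  exact h1.sub h5

/-- The tangent space varies with `x`, so continuity of the density is easier to see on the fixed
space `ℝ⁴`. As `ambientCov` kills `x`, passing to `ℝ⁴` only adds a diagonal block 1. -/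
lemma det_covDeriv_eq {v : S3 → E4} (hv : ContMDiff (𝓡 3) 𝓘(ℝ, E4) ∞ v) (x : S3) :
    LinearMap.det (LinearMap.id + LinearMap.adjoint (covDeriv v x) ∘ₗ covDeriv v x) =
      (ContinuousLinearMap.id ℝ E4 +
        (ContinuousLinearMap.adjoint (ambientCov v x)).comp (ambientCov v x)).det := by
  obtain ⟨b, hb⟩ := exists_orthonormalBasis_zero x
  obtain ⟨c, hc⟩ := exists_tanBasis b hb
  have h0 : ambientCov v x (b 0) = 0 := by
    rw [hb, ambientCov_apply, sderiv_self hv]; simp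
  have key : ∀ i j, ⟪b i, (ContinuousLinearMap.id ℝ E4 +
        (ContinuousLinearMap.adjoint (ambientCov v x)).comp (ambientCov v x)) (b j)⟫ =
      ⟪b i, b j⟫ + ⟪ambientCov v x (b i), ambientCov v x (b j)⟫ := fun i j => by
    simp [inner_add_right, ContinuousLinearMap.adjoint_inner_right]
  rw [ContinuousLinearMap.det, det_eq_det_inner b, det_eq_det_inner c,
    Matrix.det_succ_row_zero (n := 3)]
  simp only [ContinuousLinearMap.coe_coe, Matrix.of_apply, key, h0, inner_zero_left,
    inner_id_add_adjoint_comp]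
  rw [Fin.sum_univ_succ (n := 3), Finset.sum_eq_zero]
  · simp only [Fin.val_zero, pow_zero, one_mul, add_zero]
    rw [b.inner_eq_one, one_mul]
    congr 1
    ext i j
    simp only [Matrix.of_apply, Matrix.submatrix_apply, Fin.succAbove_zero,
      Submodule.coe_inner, coe_covDeriv, hc]
  · intro i _
    rw [b.inner_eq_zero (Fin.succ_ne_zero i).symm]
    simp

lemma trace_covDeriv_eq {v : S3 → E4} (x : S3) (c : OrthonormalBasis (Fin 3) ℝ (Tan x)) :
    LinearMap.trace ℝ (Tan x) (LinearMap.adjoint (covDeriv v x) ∘ₗ covDeriv v x) =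
      ∑ i, ‖covDeriv v x (c i)‖ ^ 2 := by
  rw [LinearMap.trace_eq_sum_inner _ c]
  simp [LinearMap.adjoint_inner_right]

lemma trace_covDeriv_eq_trace {v : S3 → E4} (hv : ContMDiff (𝓡 3) 𝓘(ℝ, E4) ∞ v) (x : S3) :
    LinearMap.trace ℝ (Tan x) (LinearMap.adjoint (covDeriv v x) ∘ₗ covDeriv v x) =
      ∑ i, ‖ambientCov v x (EuclideanSpace.basisFun (Fin 4) ℝ i)‖ ^ 2 := by
  obtain ⟨b, hb⟩ := exists_orthonormalBasis_zero x
  obtain ⟨c, hc⟩ := exists_tanBasis b hb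
  have h0 : ambientCov v x (b 0) = 0 := by
    rw [hb, ambientCov_apply, sderiv_self hv]; simp
  have h1 : ∀ b' : OrthonormalBasis (Fin 4) ℝ E4, ∑ i, ‖ambientCov v x (b' i)‖ ^ 2 =
      LinearMap.trace ℝ E4 (LinearMap.adjoint (ambientCov v x : E4 →ₗ[ℝ] E4) ∘ₗ
        (ambientCov v x : E4 →ₗ[ℝ] E4)) := fun b' => by
    rw [LinearMap.trace_eq_sum_inner _ b']
    simp [LinearMap.adjoint_inner_right]
  rw [trace_covDeriv_eq x c, h1, ← h1 b, Fin.sum_univ_succ (n := 3), h0]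
  simp [← hc, ← coe_covDeriv]

lemma continuous_det_covDeriv {v : S3 → E4} (hv : ContMDiff (𝓡 3) 𝓘(ℝ, E4) ∞ v) :
    Continuous fun x : S3 =>
      √(LinearMap.det (LinearMap.id + LinearMap.adjoint (covDeriv v x) ∘ₗ covDeriv v x)) := by
  simp_rw [det_covDeriv_eq hv]
  have h := continuous_ambientCov hv
  have h2 : Continuous fun x => ContinuousLinearMap.adjoint (ambientCov v x) :=
    (ContinuousLinearMap.adjoint (𝕜 := ℝ) (E := E4) (F := E4)).continuous.comp h
  exact Real.continuous_sqrt.comp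
    (ContinuousLinearMap.continuous_det.comp (continuous_const.add (h2.clm_comp h)))

lemma continuous_trace_covDeriv {v : S3 → E4} (hv : ContMDiff (𝓡 3) 𝓘(ℝ, E4) ∞ v) :
    Continuous fun x : S3 =>
      LinearMap.trace ℝ (Tan x) (LinearMap.adjoint (covDeriv v x) ∘ₗ covDeriv v x) := by
  simp_rw [trace_covDeriv_eq_trace hv]
  have h := continuous_ambientCov hv
  fun_prop

/-- Differentiate `⟪v, v⟫ = 1`. -/
lemma IsUnitField.inner_sderiv_self {v : S3 → E4} (hv : IsUnitField v) (x : S3) (u : E4) :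
    ⟪v x, sderiv v x u⟫ = 0 := by
  have h := hasFDerivAt_sderiv hv.smooth x
  have h1 := h.inner ℝ h
  have h2 : (fun y : E4 => ⟪(v ∘ dir) y, (v ∘ dir) y⟫) = fun _ => (1 : ℝ) := by
    ext y; simp [hv.unit]
  rw [h2] at h1
  have h3 := h1.unique (hasFDerivAt_const (1 : ℝ) (x : E4))
  have h4 := congrArg (fun L => L u) h3
  simp [real_inner_comm] at h4
  linarith

/-- Differentiate `⟪y, v (dir y)⟫ = 0` at `y = x`. -/
lemma inner_coe_sderiv {v : S3 → E4} (hv : ContMDiff (𝓡 3) 𝓘(ℝ, E4) ∞ v)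
    (htan : ∀ x : S3, ⟪(x : E4), v x⟫ = 0) (x : S3) (u : E4) :
    ⟪(x : E4), sderiv v x u⟫ = -⟪u, v x⟫ := by
  have h := hasFDerivAt_sderiv hv x
  have h1 := (hasFDerivAt_id (𝕜 := ℝ) (x : E4)).inner ℝ h
  have h2 : (fun y : E4 => ⟪id y, (v ∘ dir) y⟫) =ᶠ[𝓝 (x : E4)] fun _ => (0 : ℝ) := by
    filter_upwards [isOpen_ne.mem_nhds (coe_S3_ne_zero x)] with y hy
    have := htan (dir y)
    rw [coe_dir hy, real_inner_smul_left] at this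
    simpa [hy] using this
  have h3 := h1.unique ((hasFDerivAt_const (0 : ℝ) (x : E4)).congr_of_eventuallyEq h2)
  have h4 := congrArg (fun L => L u) h3
  simp at h4
  linarith

/-- The divergence of a tangent field. -/
noncomputable def sdiv (v : S3 → E4) (x : S3) : ℝ :=
  LinearMap.trace ℝ E4 (sderiv v x : E4 →ₗ[ℝ] E4)

lemma sdiv_eq_sum (v : S3 → E4) (x : S3) (b : OrthonormalBasis (Fin 4) ℝ E4) :
    sdiv v x = ∑ i, ⟪b i, sderiv v x (b i)⟫ := by
  rw [sdiv, LinearMap.trace_eq_sum_inner _ b]; rfl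

/-- The derivative at `x` of the degree one homogeneous extension of `x ↦ x + t v(x)`. -/
noncomputable def coneDeriv (v : S3 → E4) (t : ℝ) (x : S3) : E4 →L[ℝ] E4 :=
  ContinuousLinearMap.id ℝ E4 + t • ((innerSL ℝ (x : E4)).smulRight (v x) + sderiv v x)

/-- The radicand is `det(Id + AᵀA)` for the 2×3 matrix `A` with columns `(c₁, c₂)`, `(p, r)`, `(q,
s)`. By Cauchy–Binet it is 1 plus the squares of all entries plus the squares of the three 2×2
minors. Dropping all that involves `c₁`, `c₂` and using `2|ps - qr| ≤ p² + q² + r² + s²` leaves a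
perfect square. -/
lemma one_add_abs_le_sqrt_det (c₁ c₂ p q r s : ℝ) :
    1 + |p * s - q * r| ≤ √((1 + (c₁ ^ 2 + c₂ ^ 2)) * ((1 + (p ^ 2 + r ^ 2)) * (1 + (q ^ 2 + s ^ 2))
      - (p * q + r * s) ^ 2)
      - (c₁ * p + c₂ * r) * ((c₁ * p + c₂ * r) * (1 + (q ^ 2 + s ^ 2))
        - (p * q + r * s) * (c₁ * q + c₂ * s))
      + (c₁ * q + c₂ * s) * ((c₁ * p + c₂ * r) * (p * q + r * s)
        - (1 + (p ^ 2 + r ^ 2)) * (c₁ * q + c₂ * s))) := by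
  apply Real.le_sqrt_of_sq_le
  have h1 : 2 * |p * s - q * r| ≤ p ^ 2 + q ^ 2 + r ^ 2 + s ^ 2 := by
    rcases abs_cases (p * s - q * r) with ⟨h, _⟩ | ⟨h, _⟩ <;> rw [h] <;>
      nlinarith [sq_nonneg (p - s), sq_nonneg (q + r), sq_nonneg (p + s), sq_nonneg (q - r)]
  have h2 := sq_abs (p * s - q * r)
  nlinarith [sq_nonneg (c₁ * r - c₂ * p), sq_nonneg (c₁ * s - c₂ * q), sq_nonneg c₁, sq_nonneg c₂]

/-- The second elementary symmetric function `s₂` of the second fundamental form of `v^⊥`: it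
controls the volume and energy densities and appears in the Jacobian of `x ↦ x + t v(x)`. -/
lemma IsUnitField.exists_pointwise {v : S3 → E4} (hv : IsUnitField v) (t : ℝ) (x : S3) :
    ∃ s₂ : ℝ, (coneDeriv v t x).det = (1 + t ^ 2) * (1 + t * sdiv v x + t ^ 2 * s₂) ∧
      1 + |s₂| ≤ √(LinearMap.det
        (LinearMap.id + LinearMap.adjoint (covDeriv v x) ∘ₗ covDeriv v x)) ∧
      2 * |s₂| ≤ LinearMap.trace ℝ (Tan x)
        (LinearMap.adjoint (covDeriv v x) ∘ₗ covDeriv v x) := by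
  obtain ⟨b, hb0, hb1⟩ := exists_orthonormalBasis (norm_coe_S3 x) (hv.unit x) (hv.tangent x)
  obtain ⟨c, hc⟩ := exists_tanBasis b hb0
  set a := sderiv v x with ha
  have ha0 : a (b 0) = 0 := by rw [hb0, ha, sderiv_self hv.smooth]
  have hr0 : ∀ u, ⟪b 0, a u⟫ = -⟪b 1, u⟫ := fun u => by
    rw [hb0, hb1, ha, inner_coe_sderiv hv.smooth hv.tangent, real_inner_comm]
  have hr1 : ∀ u, ⟪b 1, a u⟫ = 0 := fun u => by rw [hb1, ha, hv.inner_sderiv_self]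
  have hbb : ∀ i j, ⟪b i, b j⟫ = if i = j then 1 else 0 := fun i j => b.inner_eq_ite i j
  have hcov : ∀ i : Fin 4, ∀ u, ⟪b i, ambientCov v x u⟫ =
      if i = 0 then 0 else ⟪b i, a u⟫ := fun i u => by
    rw [ambientCov_apply, ← ha, inner_sub_right, real_inner_smul_right, ← hb0, hbb]
    by_cases hi : i = 0 <;> simp [hi]
  have hgram : ∀ i j, ⟪ambientCov v x (b i), ambientCov v x (b j)⟫ =
      ⟪b 2, a (b i)⟫ * ⟪b 2, a (b j)⟫ + ⟪b 3, a (b i)⟫ * ⟪b 3, a (b j)⟫ := fun i j => by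
    rw [← b.sum_inner_mul_inner]
    simp only [Fin.sum_univ_four, real_inner_comm (b _) (ambientCov v x (b i)), hcov]
    simp [hr1]
  have hG : ∀ i j, ⟪c i, (LinearMap.id + LinearMap.adjoint (covDeriv v x) ∘ₗ covDeriv v x :
      Tan x →ₗ[ℝ] Tan x) (c j)⟫ =
      (if i = j then 1 else 0) + (⟪b 2, a (b i.succ)⟫ * ⟪b 2, a (b j.succ)⟫ +
        ⟪b 3, a (b i.succ)⟫ * ⟪b 3, a (b j.succ)⟫) := fun i j => by
    rw [inner_id_add_adjoint_comp, c.inner_eq_ite, Submodule.coe_inner, coe_covDeriv, coe_covDeriv,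
      hc, hc, hgram]
  -- The frame starts with `x` and `v x`, so `b 2`, `b 3` span the plane orthogonal to both.
  refine ⟨⟪b 2, a (b 2)⟫ * ⟪b 3, a (b 3)⟫ - ⟪b 2, a (b 3)⟫ * ⟪b 3, a (b 2)⟫, ?_, ?_, ?_⟩
  · rw [ContinuousLinearMap.det, det_eq_det_inner b, sdiv_eq_sum v x b]
    -- The first two rows are `(1, -t, 0, 0)` and `(t, 1, 0, 0)`, which gives the factor `1 + t²`.
    -- The other factor is the determinant of `Id + t B` for the lower right block `B`, whose trace
    -- is all of `sdiv v x`.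
    have hM : ∀ i j, ⟪b i, coneDeriv v t x (b j)⟫ = (if i = j then 1 else 0) +
        t * ((if 0 = j then 1 else 0) * (if i = 1 then 1 else 0) + ⟪b i, a (b j)⟫) := fun i j => by
      simp only [coneDeriv, add_apply, smul_apply, ContinuousLinearMap.smulRight_apply,
        innerSL_apply_apply, ContinuousLinearMap.id_apply, inner_add_right,
        real_inner_smul_right, ← hb0, ← hb1, hbb, ← ha]
    simp only [ContinuousLinearMap.coe_coe, hM, ← ha]
    simp only [Matrix.det_succ_row_zero, Fin.sum_univ_succ]
    simp [Fin.succAbove, hr0, hr1, hbb, ha0]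
    ring
  · refine (one_add_abs_le_sqrt_det ⟪b 2, a (b 1)⟫ ⟪b 3, a (b 1)⟫ _ _ _ _).trans (le_of_eq ?_)
    rw [det_eq_det_inner c, Matrix.det_fin_three]
    simp only [Matrix.of_apply, hG]
    congr 1
    simp
    ring
  · rw [trace_covDeriv_eq x c]
    have h3 : ∀ i, ‖covDeriv v x (c i)‖ ^ 2 =
        ⟪b 2, a (b i.succ)⟫ ^ 2 + ⟪b 3, a (b i.succ)⟫ ^ 2 := fun i => by
      rw [← real_inner_self_eq_norm_sq, Submodule.coe_inner, coe_covDeriv, hc, hgram]; ring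
    rw [Fin.sum_univ_three, h3, h3, h3]
    simp only [Fin.succ_zero_eq_one, Fin.succ_one_eq_two]
    rw [show (2 : Fin 3).succ = 3 from rfl]
    set p := ⟪b 2, a (b 2)⟫
    set q := ⟪b 2, a (b 3)⟫
    set r := ⟪b 3, a (b 2)⟫
    set s := ⟪b 3, a (b 3)⟫
    rcases abs_cases (p * s - q * r) with ⟨h, _⟩ | ⟨h, _⟩ <;> rw [h] <;>
      nlinarith [sq_nonneg (p - s), sq_nonneg (q + r), sq_nonneg (p + s), sq_nonneg (q - r),
        sq_nonneg ⟪b 2, a (b 1)⟫, sq_nonneg ⟪b 3, a (b 1)⟫]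

/-! ### Hopf fields -/

lemma hasFDerivAt_norm_dir {y : E4} (hy : y ≠ 0) :
    HasFDerivAt (fun y : E4 => ‖y‖) (innerSL ℝ (dir y : E4)) y := by
  have hy' := norm_ne_zero_iff.2 hy
  have h3 := (hasStrictFDerivAt_norm_sq y).hasFDerivAt.sqrt (by positivity)
  simp only [Real.sqrt_sq (norm_nonneg _)] at h3
  have h4 : (1 / (2 * ‖y‖)) • (2 : ℕ) • innerSL ℝ y = innerSL ℝ (dir y : E4) := by
    rw [coe_dir hy, map_smul, ← Nat.cast_smul_eq_nsmul ℝ, smul_smul]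
    congr 1
    push_cast
    field_simp
  rwa [h4] at h3

lemma hasFDerivAt_norm_S3 (x : S3) :
    HasFDerivAt (fun y : E4 => ‖y‖) (innerSL ℝ (x : E4)) (x : E4) := by
  simpa using hasFDerivAt_norm_dir (coe_S3_ne_zero x)

/-- Differentiate `‖y‖ • dir y = y`. -/
lemma sderiv_coe_apply (x : S3) (u : E4) :
    sderiv (fun x : S3 => (x : E4)) x u = u - ⟪(x : E4), u⟫ • (x : E4) := by
  have h1 := hasFDerivAt_sderiv contMDiff_coe x
  have h2 := hasFDerivAt_norm_S3 x
  have h4 := h2.smul h1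
  have h5 : ((fun y : E4 => ‖y‖) • ((fun x : S3 => (x : E4)) ∘ dir)) =ᶠ[𝓝 (x : E4)] id := by
    filter_upwards [isOpen_ne.mem_nhds (coe_S3_ne_zero x)] with y hy
    exact norm_smul_dir hy
  have h6 := h4.unique ((hasFDerivAt_id (x : E4)).congr_of_eventuallyEq h5)
  have h7 := congrArg (fun L => L u) h6
  simp at h7
  exact eq_sub_of_add_eq h7

section Hopf

variable {H : S3 → E4} {J : E4 →ₗᵢ[ℝ] E4}

lemma inner_hopf (hJ : ∀ x, J (J x) = -x) (x y : E4) : ⟪x, J y⟫ = -⟪J x, y⟫ := by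
  rw [← J.inner_map_map x, hJ, inner_neg_right]

lemma IsHopfField.isUnitField (hH : IsHopfField H) : IsUnitField H := by
  obtain ⟨J, hJ, hHJ⟩ := hH
  have hH' : H = fun x : S3 => J x := funext hHJ
  subst hH'
  refine ⟨?_, fun x => ?_, fun x => by simp⟩
  · exact J.contDiff.contMDiff.comp contMDiff_coe
  · have h := inner_hopf hJ (x : E4) (x : E4)
    rw [real_inner_comm (x : E4) (J x)] at h
    linarith

lemma sderiv_hopf (x : S3) (u : E4) :
    sderiv (fun x : S3 => J x) x u = J u - ⟪(x : E4), u⟫ • J x := by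
  have h1 := J.toContinuousLinearMap.hasFDerivAt.comp (x : E4) (hasFDerivAt_sderiv contMDiff_coe x)
  have h2 : sderiv (fun x : S3 => J x) x =
      J.toContinuousLinearMap.comp (sderiv (fun x : S3 => (x : E4)) x) := h1.fderiv
  rw [h2, ContinuousLinearMap.comp_apply, sderiv_coe_apply]
  simp

/-- The covariant derivative of a Hopf field is a rotation by a right angle of the plane field
orthogonal to it. -/
lemma IsHopfField.pointwise (hH : IsHopfField H) (x : S3) :
    √(LinearMap.det (LinearMap.id + LinearMap.adjoint (covDeriv H x) ∘ₗ covDeriv H x)) = 2 ∧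
      LinearMap.trace ℝ (Tan x) (LinearMap.adjoint (covDeriv H x) ∘ₗ covDeriv H x) = 2 := by
  have hu := hH.isUnitField
  obtain ⟨J, hJ, hHJ⟩ := hH
  have hH' : H = fun x : S3 => J x := funext hHJ
  subst hH'
  obtain ⟨b, hb0, hb1⟩ := exists_orthonormalBasis (norm_coe_S3 x) (hu.unit x) (hu.tangent x)
  obtain ⟨c, hc⟩ := exists_tanBasis b hb0
  have hbb : ∀ i j, ⟪b i, b j⟫ = if i = j then 1 else 0 := fun i j => b.inner_eq_ite i j
  have hcov : ∀ i : Fin 3, (covDeriv (fun x : S3 => J x) x (c i) : E4) =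
      if i = 0 then 0 else J (b i.succ) := by
    intro i
    rw [coe_covDeriv, hc, ambientCov_apply, sderiv_hopf, ← hb0, hbb,
      if_neg (Fin.succ_ne_zero i).symm,
      zero_smul, sub_zero]
    -- Along `H` itself the derivative is `J (J x) = -x`, which is normal, so its tangential part
    -- vanishes. On the orthogonal plane `J` takes tangent values and nothing is projected away.
    split_ifs with hi
    · subst hi
      rw [Fin.succ_zero_eq_one, hb1, hJ, ← hb0, inner_neg_right, hbb]
      simp
    · rw [inner_hopf hJ, hb0, ← hb1, hbb, if_neg]
      · simp
      · intro h
        exact hi (Fin.succ_injective _ h.symm)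
  have hG : ∀ i j, ⟪covDeriv (fun x : S3 => J x) x (c i), covDeriv (fun x : S3 => J x) x (c j)⟫ =
      if i = j then (if i = 0 then 0 else 1) else 0 := by
    intro i j
    rw [Submodule.coe_inner, hcov, hcov]
    by_cases hi : i = 0
    · simp [hi]
    · by_cases hj : j = 0
      · simp [hj]
      · simp only [hi, hj, if_false, J.inner_map_map, hbb, Fin.succ_inj]
  constructor
  · rw [det_eq_det_inner c, Matrix.det_fin_three]
    simp only [Matrix.of_apply, inner_id_add_adjoint_comp, hG, c.inner_eq_ite]
    have h : (√4 : ℝ) = 2 := by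
      rw [show (4 : ℝ) = 2 ^ 2 by norm_num]; exact Real.sqrt_sq (by norm_num)
    simp [Fin.ext_iff]
    norm_num [h]
  · rw [trace_covDeriv_eq x c, Fin.sum_univ_three]
    simp only [← real_inner_self_eq_norm_sq, hG]
    simp [Fin.ext_iff]
    norm_num

end Hopf

/-! ### Polar coordinates -/

lemma measurable_dir : Measurable dir :=
  measurable_of_continuousOn_compl_singleton 0
    fun _ hy => (continuousAt_dir hy).continuousWithinAt

instance : IsFiniteMeasure vol3 := by unfold vol3; infer_instance

/-- The homeomorphism of `ℝ⁴ \ {0}` with `S³ × (0, ∞)` turns Lebesgue measure into the product of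
`vol3` and `r³ dr`, and the integrand separates. -/
lemma integral_polar (κ : ℝ → ℝ) (f : S3 → ℝ) :
    ∫ y : E4, f (dir y) * κ ‖y‖ = (∫ x, f x ∂vol3) * ∫ r in Ioi (0 : ℝ), r ^ 3 * κ r :=
  calc
    ∫ y : E4, f (dir y) * κ ‖y‖
      = ∫ y : ({(0 : E4)}ᶜ : Set E4), f (dir y) * κ ‖(y : E4)‖ ∂(volume.comap Subtype.val) := by
      rw [integral_subtype_comap (measurableSet_singleton _).compl
        fun y : E4 ↦ f (dir y) * κ ‖y‖, restrict_compl_singleton]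
    _ = ∫ z, f z.1 * κ z.2 ∂vol3.prod (.volumeIoiPow (Module.finrank ℝ E4 - 1)) := by
      have h := (volume : Measure E4).measurePreserving_homeomorphUnitSphereProd.integral_comp
        (Homeomorph.measurableEmbedding _) (fun z => f z.1 * κ z.2)
      rw [← vol3] at h
      rw [← h]
      refine integral_congr_ae (.of_forall fun y => ?_)
      have hy : (y : E4) ≠ 0 := y.2
      have : (homeomorphUnitSphereProd E4 y).1 = dir y := by
        ext1; simp [coe_dir hy]
      simp only [this, homeomorphUnitSphereProd_apply_snd_coe]
    _ = (∫ x, f x ∂vol3) *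
        ∫ r : Ioi (0 : ℝ), κ r ∂.volumeIoiPow (Module.finrank ℝ E4 - 1) :=
      integral_prod_mul f (fun r : Ioi (0 : ℝ) => κ r)
    _ = _ := by
      congr 1
      simp only [Measure.volumeIoiPow, ENNReal.ofReal]
      rw [integral_withDensity_eq_integral_smul (by fun_prop)]
      rw [integral_subtype_comap measurableSet_Ioi
        fun r : ℝ ↦ Real.toNNReal (r ^ (Module.finrank ℝ E4 - 1)) • κ r]
      apply setIntegral_congr_fun measurableSet_Ioi
      intro r (hr : 0 < r)
      have : Module.finrank ℝ E4 = 4 := by simp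
      simp only [this]
      rw [NNReal.smul_def, Real.coe_toNNReal _ (by positivity), smul_eq_mul]

/-- The open cone of height one over a subset of the sphere. -/
def coneSet (A : Set S3) : Set E4 := {y | ‖y‖ ∈ Ioo (0 : ℝ) 1 ∧ dir y ∈ A}

open scoped Pointwise in
lemma coneSet_eq (A : Set S3) : coneSet A = Ioo (0 : ℝ) 1 • ((↑) '' A : Set E4) := by
  ext y
  constructor
  · rintro ⟨hy, hA⟩
    exact ⟨‖y‖, hy, dir y, ⟨_, hA, rfl⟩, norm_smul_dir (norm_pos_iff.1 hy.1)⟩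
  · rintro ⟨r, hr, _, ⟨x, hx, rfl⟩, rfl⟩
    have h0 : ‖r • (x : E4)‖ = r := by simp [norm_smul, abs_of_pos hr.1]
    refine ⟨?_, ?_⟩
    · simpa only [h0] using hr
    · simpa [dir_smul hr.1] using hx

lemma measurableSet_coneSet {A : Set S3} (hA : MeasurableSet A) : MeasurableSet (coneSet A) :=
  (measurable_norm measurableSet_Ioo).inter (measurable_dir hA)

lemma vol3_apply {A : Set S3} (hA : MeasurableSet A) : vol3 A = 4 * volume (coneSet A) := by
  rw [vol3, Measure.toSphere_apply' _ hA, coneSet_eq]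
  simp

lemma integral_Ioo_cube : ∫ r in Ioi (0 : ℝ), r ^ 3 * (Ioo (0 : ℝ) 1).indicator 1 r = 1 / 4 := by
  have h1 : ∀ r : ℝ, r ^ 3 * (Ioo (0 : ℝ) 1).indicator 1 r =
      (Ioo (0 : ℝ) 1).indicator (fun r => r ^ 3) r := fun r => by
    by_cases hr : r ∈ Ioo (0 : ℝ) 1 <;> simp [hr]
  simp_rw [h1]
  rw [setIntegral_indicator measurableSet_Ioo,
    inter_eq_self_of_subset_right (fun r hr => hr.1), ← integral_Ioc_eq_integral_Ioo,
    ← intervalIntegral.integral_of_le zero_le_one, integral_pow]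
  norm_num

/-- The degree one homogeneous extension of a self-map of the sphere. -/
noncomputable def coneMap (ψ : S3 → S3) (y : E4) : E4 := ‖y‖ • (ψ (dir y) : E4)

lemma norm_coneMap (ψ : S3 → S3) (y : E4) : ‖coneMap ψ y‖ = ‖y‖ := by simp [coneMap, norm_smul]

lemma dir_coneMap (ψ : S3 → S3) {y : E4} (hy : y ≠ 0) : dir (coneMap ψ y) = ψ (dir y) := by
  rw [coneMap, dir_smul (norm_pos_iff.2 hy), dir_coe]

lemma coneMap_image (ψ : S3 → S3) (A : Set S3) : coneMap ψ '' coneSet A = coneSet (ψ '' A) := by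
  ext z
  constructor
  · rintro ⟨y, ⟨hy, hA⟩, rfl⟩
    refine ⟨by rwa [norm_coneMap], ?_⟩
    rw [dir_coneMap ψ (norm_pos_iff.1 hy.1)]
    exact mem_image_of_mem _ hA
  · rintro ⟨hz, x, hx, hxz⟩
    have h1 : ‖‖z‖ • (x : E4)‖ = ‖z‖ := by simp [norm_smul]
    have h2 : dir (‖z‖ • (x : E4)) = x := by rw [dir_smul hz.1, dir_coe]
    refine ⟨‖z‖ • (x : E4), ⟨by rwa [h1], by rwa [h2]⟩, ?_⟩
    rw [coneMap, h1, h2, hxz, norm_smul_dir (norm_pos_iff.1 hz.1)]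

lemma coneMap_injOn {ψ : S3 → S3} (hψ : Function.Injective ψ) (A : Set S3) :
    InjOn (coneMap ψ) (coneSet A) := by
  rintro y ⟨hy, _⟩ z ⟨hz, _⟩ hyz
  have h1 : ‖y‖ = ‖z‖ := by rw [← norm_coneMap ψ y, hyz, norm_coneMap]
  have h2 : dir y = dir z := by
    apply hψ
    rw [← dir_coneMap ψ (norm_pos_iff.1 hy.1), hyz, dir_coneMap ψ (norm_pos_iff.1 hz.1)]
  rw [← norm_smul_dir (norm_pos_iff.1 hy.1), h1, h2, norm_smul_dir (norm_pos_iff.1 hz.1)]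

/-- Change of variables on the sphere. -/
lemma vol3_real_image {ψ : S3 → S3} (hψ : Function.Injective ψ) {D : S3 → E4 →L[ℝ] E4}
    (hD : ∀ y : E4, y ≠ 0 → HasFDerivAt (coneMap ψ) (D (dir y)) y) {A : Set S3}
    (hA : MeasurableSet A) (hψA : MeasurableSet (ψ '' A)) :
    vol3.real (ψ '' A) = ∫ x in A, |(D x).det| ∂vol3 := by
  have h1 : volume.real (coneSet (ψ '' A)) = ∫ y in coneSet A, |(D (dir y)).det| := by
    have h := integral_image_eq_integral_abs_det_fderiv_smul (volume : Measure E4)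
      (measurableSet_coneSet hA)
      (fun y hy => (hD y (norm_pos_iff.1 hy.1.1)).hasFDerivWithinAt) (coneMap_injOn hψ A)
      (fun _ => (1 : ℝ))
    rw [coneMap_image] at h
    simpa using h
  -- The Jacobian of a degree one map depends on the direction only, so the integral over the cone
  -- separates in polar coordinates. The radial factor `1 / 4` cancels the 4 of `vol3_apply`.
  have h2 : ∀ y : E4, (coneSet A).indicator (fun y => |(D (dir y)).det|) y =
      A.indicator (fun x => |(D x).det|) (dir y) * (Ioo (0 : ℝ) 1).indicator 1 ‖y‖ := fun y => by
    by_cases h1 : ‖y‖ ∈ Ioo (0 : ℝ) 1 <;> by_cases h2 : dir y ∈ A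
    · have : y ∈ coneSet A := ⟨h1, h2⟩
      simp [this, h1, h2]
    all_goals
      have : y ∉ coneSet A := fun h => by first | exact h1 h.1 | exact h2 h.2
      simp [this, h1, h2]
  rw [Measure.real, vol3_apply hψA, ENNReal.toReal_mul, ← Measure.real, h1,
    ← integral_indicator (measurableSet_coneSet hA)]
  simp_rw [h2]
  rw [integral_polar, integral_Ioo_cube, integral_indicator hA]
  simp
  ring

/-! ### The Jacobian of a diffeomorphism of the sphere -/

/-- The derivative of the degree one homogeneous extension of `w`. -/
noncomputable def homDeriv (w : S3 → E4) (x : S3) : E4 →L[ℝ] E4 :=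
  sderiv w x + (innerSL ℝ (x : E4)).smulRight (w x)

/-- The factor `‖y‖` cancels the degree `-1` of the derivative of `w ∘ dir`, so the result depends
on `dir y` alone. -/
lemma hasFDerivAt_hom {w : S3 → E4} (hw : ContMDiff (𝓡 3) 𝓘(ℝ, E4) ∞ w) {y : E4} (hy : y ≠ 0) :
    HasFDerivAt (fun y : E4 => ‖y‖ • w (dir y)) (homDeriv w (dir y)) y := by
  have h := (hasFDerivAt_norm_dir hy).smul (hasFDerivAt_comp_dir hw hy)
  rw [smul_smul, mul_inv_cancel₀ (norm_ne_zero_iff.2 hy), one_smul] at h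
  exact h

lemma continuous_homDeriv {w : S3 → E4} (hw : ContMDiff (𝓡 3) 𝓘(ℝ, E4) ∞ w) :
    Continuous (homDeriv w) := by
  have h2 : Continuous fun x : S3 => innerSL ℝ (x : E4) :=
    (innerSL ℝ).continuous.comp continuous_subtype_val
  exact (continuous_sderiv hw).add
    (((ContinuousLinearMap.smulRightL ℝ E4 E4).continuous.comp h2).clm_apply hw.continuous)

lemma homDeriv_flow {v : S3 → E4} (hv : ContMDiff (𝓡 3) 𝓘(ℝ, E4) ∞ v) (t r : ℝ) (x : S3) :
    homDeriv (fun x : S3 => r⁻¹ • ((x : E4) + t • v x)) x = r⁻¹ • coneDeriv v t x := by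
  have hs : sderiv (fun x : S3 => r⁻¹ • ((x : E4) + t • v x)) x =
      r⁻¹ • (sderiv (fun x : S3 => (x : E4)) x + t • sderiv v x) :=
    (((hasFDerivAt_sderiv contMDiff_coe x).fun_add
      ((hasFDerivAt_sderiv hv x).fun_const_smul t)).fun_const_smul r⁻¹).fderiv
  ext1 u
  simp only [homDeriv, hs, coneDeriv, add_apply, smul_apply, ContinuousLinearMap.smulRight_apply,
    innerSL_apply_apply, ContinuousLinearMap.id_apply, sderiv_coe_apply]
  module

lemma hasFDerivAt_coneMap {ψ : S3 → S3} (hψ : ContMDiff (𝓡 3) (𝓡 3) ∞ ψ) {y : E4} (hy : y ≠ 0) :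
    HasFDerivAt (coneMap ψ) (homDeriv (fun x => (ψ x : E4)) (dir y)) y :=
  hasFDerivAt_hom (w := fun x => (ψ x : E4)) (contMDiff_coe.comp hψ) hy

/-- The cone extensions of `ψ` and `ψ.symm` are inverse to each other off the origin; apply the
chain rule. -/
lemma det_homDeriv_ne_zero (ψ : S3 ≃ₘ^∞⟮𝓡 3, 𝓡 3⟯ S3) (x : S3) :
    (homDeriv (fun x => (ψ x : E4)) x).det ≠ 0 := by
  have hx := coe_S3_ne_zero x
  have h1 : HasFDerivAt (coneMap ψ) (homDeriv (fun x => (ψ x : E4)) x) (x : E4) := by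
    have h := hasFDerivAt_coneMap ψ.contMDiff hx
    rwa [dir_coe] at h
  have h2 : HasFDerivAt (coneMap ψ.symm) (homDeriv (fun x => (ψ.symm x : E4)) (ψ x))
      (coneMap ψ (x : E4)) := by
    have h := hasFDerivAt_coneMap ψ.symm.contMDiff (coe_S3_ne_zero (ψ x))
    have h3 : coneMap ψ (x : E4) = ψ x := by simp [coneMap]
    rw [h3]
    rwa [dir_coe] at h
  have h3 := h2.comp (x : E4) h1
  have h4 : coneMap ψ.symm ∘ coneMap ψ =ᶠ[𝓝 (x : E4)] id := by
    filter_upwards [isOpen_ne.mem_nhds hx] with y hy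
    rw [Function.comp_apply, coneMap, norm_coneMap, dir_coneMap _ hy]
    simpa using norm_smul_dir hy
  have h5 := h3.unique ((hasFDerivAt_id (x : E4)).congr_of_eventuallyEq h4)
  have h6 := congrArg (fun L : E4 →L[ℝ] E4 => L.det) h5
  intro h0
  simp only [ContinuousLinearMap.det, ContinuousLinearMap.toLinearMap_comp, LinearMap.det_comp,
    ContinuousLinearMap.coe_id, LinearMap.det_id] at h6
  rw [ContinuousLinearMap.det] at h0
  simp [h0] at h6

/-! ### The integral of a divergence over the sphere -/

lemma contDiff_cutoff {F : Type*} [NormedAddCommGroup F] [NormedSpace ℝ F] {f : E4 → F}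
    (hf : ∀ y ≠ 0, ContDiffAt ℝ ∞ f y) {κ : E4 → ℝ} (hκ : ContDiff ℝ ∞ κ)
    (h0 : κ =ᶠ[𝓝 0] 0) : ContDiff ℝ ∞ (fun y => κ y • f y) := by
  rw [contDiff_iff_contDiffAt]
  intro y
  by_cases hy : y = 0
  · subst hy
    refine (contDiffAt_const (c := (0 : F))).congr_of_eventuallyEq ?_
    filter_upwards [h0] with z hz
    simp [hz]
  · exact hκ.contDiffAt.smul (hf y hy)

/-- The radial cutoff function. -/
noncomputable def cutoff (r : ℝ) : ℝ :=
  Real.smoothTransition (r - 1) * Real.smoothTransition (4 - r)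

lemma contDiff_cutoff_real : ContDiff ℝ ∞ cutoff :=
  (Real.smoothTransition.contDiff.comp (contDiff_id.sub contDiff_const)).mul
    (Real.smoothTransition.contDiff.comp (contDiff_const.sub contDiff_id))

lemma cutoff_of_le {r : ℝ} (hr : r ≤ 1) : cutoff r = 0 := by
  rw [cutoff, Real.smoothTransition.zero_of_nonpos (by linarith), zero_mul]

lemma cutoff_of_ge {r : ℝ} (hr : 4 ≤ r) : cutoff r = 0 := by
  rw [cutoff, Real.smoothTransition.zero_of_nonpos (x := 4 - r) (by linarith), mul_zero]

lemma cutoff_nonneg (r : ℝ) : 0 ≤ cutoff r :=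
  mul_nonneg (Real.smoothTransition.nonneg _) (Real.smoothTransition.nonneg _)

/-- This radial factor is cancelled in `integral_sdiv`. Its `r⁻¹` is the degree of the divergence of
a degree zero field. -/
lemma integral_cutoff_pos : 0 < ∫ r in Ioi (0 : ℝ), r ^ 3 * (cutoff (r ^ 2) * r⁻¹) := by
  have h1 : ∫ r in Ioi (0 : ℝ), r ^ 3 * (cutoff (r ^ 2) * r⁻¹) =
      ∫ r : ℝ in Ioi (0 : ℝ), r ^ 2 * cutoff (r ^ 2) := by
    refine setIntegral_congr_fun measurableSet_Ioi fun r (hr : 0 < r) => ?_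
    field_simp
  have hc : Continuous fun r : ℝ => r ^ 2 * cutoff (r ^ 2) :=
    (continuous_id.pow 2).mul (contDiff_cutoff_real.continuous.comp (continuous_id.pow 2))
  have hsupp : HasCompactSupport fun r : ℝ => r ^ 2 * cutoff (r ^ 2) := by
    refine HasCompactSupport.intro (isCompact_Icc (a := -2) (b := 2)) fun r hr => ?_
    have : 4 ≤ r ^ 2 := by
      by_contra h
      push Not at h
      exact hr ⟨by nlinarith, by nlinarith⟩
    simp [cutoff_of_ge this]
  rw [h1, setIntegral_pos_iff_support_of_nonneg_ae]
  · have hU : IsOpen ((Function.support fun r : ℝ => r ^ 2 * cutoff (r ^ 2)) ∩ Ioi 0) :=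
      hc.isOpen_support.inter isOpen_Ioi
    refine hU.measure_pos volume ⟨√2, ?_, by simp⟩
    have h3 : cutoff 2 ≠ 0 :=
      (mul_pos (Real.smoothTransition.pos_of_pos (by norm_num))
        (Real.smoothTransition.pos_of_pos (by norm_num))).ne'
    simpa using h3
  · exact .of_forall fun r => mul_nonneg (sq_nonneg r) (cutoff_nonneg _)
  · exact (hc.integrable_of_hasCompactSupport hsupp).integrableOn

/-- Each partial derivative integrates to zero, by integration by parts against the constant 1. -/
lemma integral_trace_fderiv {f : E4 → E4} (hf : ContDiff ℝ ∞ f) (hs : HasCompactSupport f) :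
    ∫ y, LinearMap.trace ℝ E4 (fderiv ℝ f y : E4 →ₗ[ℝ] E4) = 0 := by
  set b := EuclideanSpace.basisFun (Fin 4) ℝ
  have h1 : ∀ i, ContDiff ℝ ∞ fun y => ⟪b i, f y⟫ := fun i => contDiff_const.inner ℝ hf
  have h2 : ∀ i, HasCompactSupport fun y => ⟪b i, f y⟫ := fun i =>
    hs.comp_left (g := fun z => ⟪b i, z⟫) (by simp)
  have h3 : ∀ i y, ⟪b i, fderiv ℝ f y (b i)⟫ = fderiv ℝ (fun y => ⟪b i, f y⟫) y (b i) := by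
    intro i y
    rw [fderiv_inner_apply ℝ (differentiableAt_const _)
      (hf.differentiable (by simp)).differentiableAt]
    simp
  have h4 : ∀ i, Continuous fun y => fderiv ℝ (fun y => ⟪b i, f y⟫) y (b i) := fun i =>
    ((h1 i).continuous_fderiv (by simp)).clm_apply continuous_const
  have h5 : ∀ i, Integrable fun y => fderiv ℝ (fun y => ⟪b i, f y⟫) y (b i) := fun i =>
    (h4 i).integrable_of_hasCompactSupport ((h2 i).fderiv_apply (𝕜 := ℝ) (b i))
  have h6 : ∀ i, ∫ y, fderiv ℝ (fun y => ⟪b i, f y⟫) y (b i) = 0 := by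
    intro i
    have h := integral_mul_fderiv_eq_neg_fderiv_mul_of_integrable (μ := (volume : Measure E4))
      (f := fun _ : E4 => (1 : ℝ)) (g := fun y => ⟪b i, f y⟫) (v := b i) (by simp)
      (by simpa using h5 i)
      (by simpa using (h1 i).continuous.integrable_of_hasCompactSupport (h2 i))
      (fun y _ => differentiableAt_const _)
      (fun y _ => ((h1 i).differentiable (by simp)).differentiableAt)
    simpa using h
  have h7 : ∀ y, LinearMap.trace ℝ E4 (fderiv ℝ f y : E4 →ₗ[ℝ] E4) =
      ∑ i, fderiv ℝ (fun y => ⟪b i, f y⟫) y (b i) := fun y => by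
    rw [LinearMap.trace_eq_sum_inner _ b]
    exact Finset.sum_congr rfl fun i _ => h3 i y
  simp_rw [h7]
  rw [integral_finsetSum _ fun i _ => h5 i, Finset.sum_eq_zero fun i _ => h6 i]

/-- The divergence of a tangent field integrates to zero over the sphere. -/
lemma integral_sdiv {w : S3 → E4} (hw : ContMDiff (𝓡 3) 𝓘(ℝ, E4) ∞ w)
    (htan : ∀ x : S3, ⟪(x : E4), w x⟫ = 0) : ∫ x, sdiv w x ∂vol3 = 0 := by
  have hκ : ContDiff ℝ ∞ fun y : E4 => cutoff (‖y‖ ^ 2) :=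
    contDiff_cutoff_real.comp (contDiff_norm_sq ℝ)
  have h0 : (fun y : E4 => cutoff (‖y‖ ^ 2)) =ᶠ[𝓝 0] 0 := by
    filter_upwards [ball_mem_nhds (0 : E4) one_pos] with y hy
    have : ‖y‖ < 1 := by simpa using hy
    exact cutoff_of_le (by nlinarith [norm_nonneg y])
  set f : E4 → E4 := fun y => cutoff (‖y‖ ^ 2) • w (dir y) with hf
  have hfs : ContDiff ℝ ∞ f := contDiff_cutoff (fun y hy => contDiffAt_comp_dir hw hy) hκ h0
  have hfc : HasCompactSupport f := by
    refine HasCompactSupport.intro (isCompact_closedBall (0 : E4) 2) fun y hy => ?_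
    have : 2 < ‖y‖ := by simpa using hy
    simp [hf, cutoff_of_ge (show (4 : ℝ) ≤ ‖y‖ ^ 2 by nlinarith)]
  have key : ∀ y : E4, y ≠ 0 → LinearMap.trace ℝ E4 (fderiv ℝ f y : E4 →ₗ[ℝ] E4) =
      sdiv w (dir y) * (cutoff (‖y‖ ^ 2) * ‖y‖⁻¹) := by
    intro y hy
    have hd1 : HasFDerivAt (fun y : E4 => cutoff (‖y‖ ^ 2))
        (deriv cutoff (‖y‖ ^ 2) • (2 : ℕ) • innerSL ℝ y) y :=
      ((contDiff_cutoff_real.differentiable (by simp)) _).hasDerivAt.comp_hasFDerivAt y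
        (hasStrictFDerivAt_norm_sq y).hasFDerivAt
    have hd2 := hd1.smul (hasFDerivAt_comp_dir hw hy)
    have hd3 : fderiv ℝ f y = _ := hd2.fderiv
    obtain ⟨b, hb⟩ := exists_orthonormalBasis_zero (dir y)
    -- The gradient of the cutoff is radial and `w` is tangent, so the product rule contributes
    -- nothing else to the trace.
    have hb' : ∀ i, ⟪y, b i⟫ * ⟪b i, w (dir y)⟫ = 0 := by
      intro i
      by_cases hi : i = 0
      · subst hi
        rw [hb, htan, mul_zero]
      · rw [← norm_smul_dir hy, ← hb, real_inner_smul_left, b.inner_eq_zero (Ne.symm hi)]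
        simp
    rw [sdiv_eq_sum w _ b, LinearMap.trace_eq_sum_inner _ b, Finset.sum_mul]
    refine Finset.sum_congr rfl fun i _ => ?_
    rw [hd3]
    simp only [ContinuousLinearMap.coe_coe, add_apply, smul_apply,
      ContinuousLinearMap.smulRight_apply, innerSL_apply_apply, inner_add_right,
      real_inner_smul_right, Function.comp_apply, smul_eq_mul, nsmul_eq_mul]
    linear_combination (deriv cutoff (‖y‖ ^ 2) * 2) * hb' i
  have h1 := integral_trace_fderiv hfs hfc
  have h2 : ∫ y, LinearMap.trace ℝ E4 (fderiv ℝ f y : E4 →ₗ[ℝ] E4) =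
      ∫ y : E4, sdiv w (dir y) * (fun r : ℝ => cutoff (r ^ 2) * r⁻¹) ‖y‖ := by
    refine integral_congr_ae ?_
    have : ∀ᵐ y : E4, y ≠ 0 := by simp [ae_iff]
    filter_upwards [this] with y hy using key y hy
  rw [h2, integral_polar (fun r : ℝ => cutoff (r ^ 2) * r⁻¹) (sdiv w)] at h1
  exact (mul_eq_zero.1 h1).resolve_right integral_cutoff_pos.ne'

/-! ### The inequalities for fields without flux -/

lemma continuous_sdiv {v : S3 → E4} (hv : ContMDiff (𝓡 3) 𝓘(ℝ, E4) ∞ v) : Continuous (sdiv v) := by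
  have h : sdiv v = fun x => ∑ i, ⟪EuclideanSpace.basisFun (Fin 4) ℝ i,
      sderiv v x (EuclideanSpace.basisFun (Fin 4) ℝ i)⟫ :=
    funext fun x => sdiv_eq_sum v x _
  rw [h]
  have := continuous_sderiv hv
  fun_prop

lemma continuous_integrableOn {F : Type*} [NormedAddCommGroup F] {f : S3 → F} (hf : Continuous f)
    (K : Set S3) : IntegrableOn f K vol3 :=
  (hf.integrable_of_hasCompactSupport
    (HasCompactSupport.of_compactSpace f)).integrableOn

instance : PreconnectedSpace S3 :=
  Subtype.preconnectedSpace
    (isPreconnected_sphere (by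
      rw [← Module.finrank_eq_rank, finrank_euclideanSpace_fin]; norm_num) 0 1)

/-- A nowhere vanishing continuous function on the sphere has a constant sign. -/
lemma exists_sign {f : S3 → ℝ} (hf : Continuous f) (h0 : ∀ x, f x ≠ 0) :
    ∃ s : ℝ, |s| = 1 ∧ ∀ x, |f x| = s * f x := by
  by_cases h : ∃ x, f x < 0
  · obtain ⟨x, hx⟩ := h
    refine ⟨-1, by simp, fun y => ?_⟩
    have : f y < 0 := by
      by_contra hy
      obtain ⟨z, hz⟩ := mem_range_of_exists_le_of_exists_ge hf ⟨x, hx.le⟩ ⟨y, not_lt.1 hy⟩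
      exact h0 z hz
    rw [abs_of_neg this]; ring
  · push Not at h
    exact ⟨1, by simp, fun y => by rw [abs_of_nonneg (h y), one_mul]⟩

/-- The image of `K` under `x ↦ x + t v(x)`, rescaled to the unit sphere, has volume
`∫_K |1 + t s₁ + t² s₂| / (1 + t²)`; if it is at least the volume of `K` and `s₁ = div v` has
vanishing integral, then `∫_K |s₂| ≥ vol(K)`. -/
lemma IsUnitField.vol_le_integral {K : Set S3} (hK : IsCompact K) {v : S3 → E4}
    (hv : IsUnitField v) {t : ℝ} (ht : 0 < t)
    (hdiff : IsDiffeoOntoSphere (flowMap v t) (√(1 + t ^ 2)))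
    (hdiv : ∫ x in K, sdiv v x ∂vol3 = 0)
    (hprop : radiusVol (√(1 + t ^ 2)) (flowMap v t '' K) /
        radiusVol (√(1 + t ^ 2)) (sphere 0 (√(1 + t ^ 2))) ≥ vol3.real K / vol3.real univ) :
    ∃ s₂ : S3 → ℝ, Continuous s₂ ∧ vol3.real K ≤ ∫ x in K, |s₂ x| ∂vol3 ∧
      (∀ x, 1 + |s₂ x| ≤ √(LinearMap.det
        (LinearMap.id + LinearMap.adjoint (covDeriv v x) ∘ₗ covDeriv v x))) ∧
      ∀ x, 2 * |s₂ x| ≤ LinearMap.trace ℝ (Tan x)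
        (LinearMap.adjoint (covDeriv v x) ∘ₗ covDeriv v x) := by
  choose s₂ hs₂ hvol htr using hv.exists_pointwise t
  obtain ⟨ψ, hψ⟩ := hdiff
  set r := √(1 + t ^ 2) with hr
  have hr2 : r ^ 2 = 1 + t ^ 2 := Real.sq_sqrt (by positivity)
  have hr0 : 0 < r := Real.sqrt_pos.2 (by positivity)
  have hψ' : (fun x => (ψ x : E4)) = fun x : S3 => r⁻¹ • ((x : E4) + t • v x) := by
    ext1 x
    rw [← flowMap, hψ, smul_smul, inv_mul_cancel₀ hr0.ne', one_smul]
  set D : S3 → ℝ := fun x => (homDeriv (fun x => (ψ x : E4)) x).det with hD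
  have hDc : Continuous D := ContinuousLinearMap.continuous_det.comp
    (continuous_homDeriv (contMDiff_coe.comp ψ.contMDiff))
  -- Rescaling by `r⁻¹` in dimension four costs `r⁻⁴ = (1 + t²)⁻²`, of which one factor cancels
  -- against the determinant of `coneDeriv`.
  have hDeq : ∀ x, (1 + t ^ 2) * D x = 1 + t * sdiv v x + t ^ 2 * s₂ x := by
    intro x
    have h1 : D x = r⁻¹ ^ 4 * (coneDeriv v t x).det := by
      simp only [hD, hψ', homDeriv_flow hv.smooth]
      simp [ContinuousLinearMap.det, LinearMap.det_smul]
    rw [h1, hs₂, ← hr2]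
    field_simp
  -- The values of `s₂` were chosen pointwise, but the Jacobian formula determines them by
  -- continuous data because `t ≠ 0`.
  have hs₂c : Continuous s₂ := by
    have : s₂ = fun x => ((1 + t ^ 2) * D x - 1 - t * sdiv v x) / t ^ 2 := by
      ext1 x
      rw [hDeq]
      field_simp
      ring
    rw [this]
    have := continuous_sdiv hv.smooth
    fun_prop
  refine ⟨s₂, hs₂c, ?_, hvol, htr⟩
  have hKm := hK.measurableSet
  have hvolK : vol3.real (ψ '' K) = ∫ x in K, |D x| ∂vol3 :=
    vol3_real_image ψ.injective (D := homDeriv (fun x => (ψ x : E4)))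
      (fun y hy => hasFDerivAt_coneMap ψ.contMDiff hy) hKm
      (hK.image ψ.continuous).measurableSet
  have huniv : 0 < vol3.real univ := by
    have : vol3 univ ≠ 0 := by
      rw [Measure.measure_univ_ne_zero, vol3]
      exact Measure.toSphere_ne_zero _
    exact ENNReal.toReal_pos this (measure_ne_top _ _)
  have hge : vol3.real K ≤ vol3.real (ψ '' K) := by
    have h1 : {x : S3 | r • (x : E4) ∈ flowMap v t '' K} = ψ '' K := by
      ext x
      constructor
      · rintro ⟨z, hz, hzx⟩
        rw [hψ] at hzx
        exact ⟨z, hz, Subtype.ext (smul_right_injective _ hr0.ne' hzx)⟩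
      · rintro ⟨z, hz, rfl⟩
        exact ⟨z, hz, hψ z⟩
    have h2 : {x : S3 | r • (x : E4) ∈ sphere (0 : E4) r} = univ := by
      ext x; simp [norm_smul, hr0.le]
    rw [radiusVol, radiusVol, h1, h2, mul_div_mul_left _ _ (by positivity), ge_iff_le,
      div_le_div_iff_of_pos_right huniv] at hprop
    exact hprop
  obtain ⟨s, hs1, hs⟩ := exists_sign hDc fun x => det_homDeriv_ne_zero ψ x
  have hi1 := continuous_integrableOn (continuous_sdiv hv.smooth) K
  have hi2 := continuous_integrableOn hs₂c K
  have hi0 := continuous_integrableOn (continuous_const (y := (1 : ℝ))) K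
  have hi01 : IntegrableOn (fun x => 1 + t * sdiv v x) K vol3 := hi0.add (hi1.const_mul t)
  have hint : (1 + t ^ 2) * ∫ x in K, D x ∂vol3 =
      vol3.real K + t ^ 2 * ∫ x in K, s₂ x ∂vol3 := by
    rw [← integral_const_mul]
    simp_rw [hDeq]
    rw [integral_add hi01 (hi2.const_mul _),
      integral_add hi0 (hi1.const_mul t), integral_const_mul, integral_const_mul, hdiv]
    simp
  have habs : |∫ x in K, s₂ x ∂vol3| ≤ ∫ x in K, |s₂ x| ∂vol3 := abs_integral_le_integral_abs
  have hKD : vol3.real K ≤ s * ∫ x in K, D x ∂vol3 := by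
    rw [← integral_const_mul]
    simp_rw [← hs]
    rw [← hvolK]
    exact hge
  have hK0 : 0 ≤ vol3.real K := measureReal_nonneg
  have ht2 : 0 < t ^ 2 := by positivity
  have hmain : (1 + t ^ 2) * vol3.real K ≤
      s * (vol3.real K + t ^ 2 * ∫ x in K, s₂ x ∂vol3) := by
    rw [← hint]
    nlinarith
  refine le_trans ?_ habs
  set I := ∫ x in K, s₂ x ∂vol3
  -- For a negative Jacobian the estimate reads `(1 + t²) V ≤ -(V + t² I)` with `V = vol(K) ≥ 0`,
  -- which is more than needed for `V ≤ -I`.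
  rcases eq_or_eq_neg_of_abs_eq hs1 with rfl | rfl
  · have : vol3.real K ≤ I := by nlinarith
    exact this.trans (le_abs_self _)
  · have : vol3.real K ≤ -I := by nlinarith
    exact this.trans (neg_le_abs _)

lemma main_of_integral_sdiv {K : Set S3} (hK : IsCompact K) {v : S3 → E4}
    (hv : IsUnitField v) {t : ℝ} (ht : 0 < t)
    (hdiff : IsDiffeoOntoSphere (flowMap v t) (√(1 + t ^ 2)))
    (hdiv : ∫ x in K, sdiv v x ∂vol3 = 0)
    (hprop : radiusVol (√(1 + t ^ 2)) (flowMap v t '' K) /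
        radiusVol (√(1 + t ^ 2)) (sphere 0 (√(1 + t ^ 2))) ≥ vol3.real K / vol3.real univ)
    {H : S3 → E4} (hH : IsHopfField H) :
    fieldVol K v ≥ fieldVol K H ∧ fieldVol K H = 2 * vol3.real K ∧ energy K v ≥ energy K H := by
  obtain ⟨s₂, hc, hle, hvol, htr⟩ := hv.vol_le_integral hK ht hdiff hdiv hprop
  have hfH : fieldVol K H = 2 * vol3.real K := by
    simp_rw [fieldVol, (hH.pointwise _).1]
    simp [mul_comm]
  have heH : energy K H = 3 / 2 * vol3.real K + vol3.real K := by
    simp_rw [energy, (hH.pointwise _).2]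
    simp
    ring
  have hi := continuous_integrableOn hc.abs K
  have hi0 := continuous_integrableOn (continuous_const (y := (1 : ℝ))) K
  refine ⟨?_, hfH, ?_⟩
  · rw [hfH, ge_iff_le]
    calc 2 * vol3.real K ≤ ∫ x in K, (1 + |s₂ x|) ∂vol3 := by
          rw [integral_add hi0 hi]; simp; linarith
      _ ≤ fieldVol K v := integral_mono (hi0.add hi)
          (continuous_integrableOn (continuous_det_covDeriv hv.smooth) K) hvol
  · rw [heH, ge_iff_le, energy]
    have : ∫ x in K, 2 * |s₂ x| ∂vol3 ≤ ∫ x in K, LinearMap.trace ℝ (Tan x)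
        (LinearMap.adjoint (covDeriv v x) ∘ₗ covDeriv v x) ∂vol3 :=
      integral_mono (hi.const_mul 2)
        (continuous_integrableOn (continuous_trace_covDeriv hv.smooth) K) htr
    rw [integral_const_mul] at this
    linarith

/-! ### Defining functions and conormals -/

/-- The gradient of a function on the sphere. -/
noncomputable def sgrad (h : S3 → ℝ) (x : S3) : E4 :=
  (InnerProductSpace.toDual ℝ E4).symm (sderiv h x)

lemma inner_sgrad (h : S3 → ℝ) (x : S3) (u : E4) : ⟪sgrad h x, u⟫ = sderiv h x u := by
  simp [sgrad]

lemma continuous_sgrad {h : S3 → ℝ} (hh : ContMDiff (𝓡 3) 𝓘(ℝ, ℝ) ∞ h) : Continuous (sgrad h) :=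
  (InnerProductSpace.toDual ℝ E4).symm.continuous.comp (continuous_sderiv hh)

lemma inner_coe_sgrad {h : S3 → ℝ} (hh : ContMDiff (𝓡 3) 𝓘(ℝ, ℝ) ∞ h) (x : S3) :
    ⟪(x : E4), sgrad h x⟫ = 0 := by
  rw [real_inner_comm, inner_sgrad, sderiv_self hh]

/-- `h` is a defining function of `K` near `p`. -/
structure IsDefiningAt (K : Set S3) (p : S3) (h : S3 → ℝ) : Prop where
  smooth : ContMDiff (𝓡 3) 𝓘(ℝ, ℝ) ∞ h
  mem_iff : ∀ᶠ y in 𝓝 p, y ∈ K ↔ 0 ≤ h y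
  sgrad_ne : sgrad h p ≠ 0

lemma IsDefiningAt.eventually {K : Set S3} {p : S3} {h : S3 → ℝ} (hd : IsDefiningAt K p h) :
    ∀ᶠ q in 𝓝 p, IsDefiningAt K q h := by
  filter_upwards [hd.mem_iff.eventually_nhds,
    (continuous_sgrad hd.smooth).continuousAt.eventually_ne hd.sgrad_ne] with q h1 h2
  exact ⟨hd.smooth, h1, h2⟩

lemma IsDefiningAt.eq_zero {K : Set S3} (hK : IsClosed K) {p : S3} {h : S3 → ℝ}
    (hd : IsDefiningAt K p h) (hp : p ∈ frontier K) : h p = 0 := by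
  have h0 : 0 ≤ h p := hd.mem_iff.self_of_nhds.1 (hK.frontier_subset hp)
  refine le_antisymm (not_lt.1 fun hlt => hp.2 ?_) h0
  rw [mem_interior_iff_mem_nhds]
  filter_upwards [hd.mem_iff, hd.smooth.continuous.continuousAt.eventually (lt_mem_nhds hlt)]
    with y h1 h2
  exact h1.2 h2.le

/-- The first chart coordinate times a bump function is globally smooth and agrees with the
coordinate near `p`. -/
lemma IsDomain3.exists_isDefiningAt {K : Set S3} (hK : IsDomain3 K) {p : S3}
    (hp : p ∈ frontier K) : ∃ h, IsDefiningAt K p h := by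
  obtain ⟨e, he, hpe, hKe⟩ := hK.halfSpaceChart p hp
  obtain ⟨f, -, hf⟩ := (SmoothBumpFunction.nhds_basis_tsupport (I := 𝓡 3) p).mem_iff.1
    (e.open_source.mem_nhds hpe)
  set h : S3 → ℝ := fun y => f y * e y 0 with hh
  have hsupp : tsupport h ⊆ tsupport f := closure_mono fun y hy hfy => hy (by simp [hh, hfy])
  have hsm : ContMDiff (𝓡 3) 𝓘(ℝ, ℝ) ∞ h := by
    refine contMDiff_of_tsupport fun y hy => ?_
    have h1 : ContMDiffAt (𝓡 3) 𝓘(ℝ, ℝ) ∞ (fun y => e y 0) y := by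
      have h2 := contMDiffAt_of_mem_maximalAtlas he (hf (hsupp hy))
      exact (EuclideanSpace.proj (𝕜 := ℝ) (0 : Fin 3)).contDiff.contMDiff.contMDiffAt.comp y h2
    exact f.contMDiff.contMDiffAt.mul h1
  have hloc : h =ᶠ[𝓝 p] fun y => e y 0 := by
    filter_upwards [f.eventuallyEq_one] with y hy
    simp [hh, hy]
  refine ⟨h, hsm, ?_, ?_⟩
  · filter_upwards [hloc, e.open_source.mem_nhds hpe] with y h1 h2
    rw [h1, hKe y h2]
  -- Along the inverse chart image of this line `h` grows with slope 1, so its gradient cannot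
  -- vanish.
  · set γ : ℝ → EuclideanSpace ℝ (Fin 3) := fun s => e p + s • EuclideanSpace.single 0 1 with hγ
    have hγ0 : γ 0 = e p := by simp [hγ]
    have hγd : DifferentiableAt ℝ γ 0 := by fun_prop
    have hγc : ContinuousAt γ 0 := hγd.continuousAt
    have hpt : e p ∈ e.target := e.map_source hpe
    have h1 : DifferentiableAt ℝ (fun z => (e.symm z : E4)) (γ 0) := by
      rw [hγ0]
      have h2 := contMDiff_coe.contMDiffAt.comp (e p)
        (contMDiffAt_symm_of_mem_maximalAtlas he hpt)
      exact h2.contDiffAt.differentiableAt (by simp)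
    have h3 := (h1.comp (0 : ℝ) hγd).hasDerivAt
    have h4 : HasFDerivAt (h ∘ dir) (sderiv h p) (((fun z => (e.symm z : E4)) ∘ γ) 0) := by
      have : ((fun z => (e.symm z : E4)) ∘ γ) 0 = p := by simp [hγ0, e.left_inv hpe]
      rw [this]
      exact hasFDerivAt_sderiv hsm p
    have h5 := h4.comp_hasDerivAt (0 : ℝ) h3
    have h6 : (h ∘ dir) ∘ ((fun z => (e.symm z : E4)) ∘ γ) =ᶠ[𝓝 0] fun s => e p 0 + s := by
      have h7 : ∀ᶠ s in 𝓝 (0 : ℝ), γ s ∈ e.target :=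
        hγc.eventually (by rw [hγ0]; exact e.open_target.mem_nhds hpt)
      have h8 : Tendsto (fun s => e.symm (γ s)) (𝓝 0) (𝓝 p) := by
        have h9 : ContinuousAt e.symm (γ 0) := by
          rw [hγ0]; exact e.continuousAt_symm hpt
        have := h9.comp hγc
        rw [ContinuousAt, Function.comp_apply, hγ0, e.left_inv hpe] at this
        exact this
      filter_upwards [h7, h8.eventually hloc] with s h9 h10
      simp only [Function.comp_apply, dir_coe, h10, e.right_inv h9]
      simp [hγ]
    have h7 : HasDerivAt (fun s : ℝ => e p 0 + s) 1 0 := (hasDerivAt_id 0).const_add _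
    have h8 := h5.unique (h7.congr_of_eventuallyEq h6)
    intro h0
    rw [← inner_sgrad, h0, inner_zero_left] at h8
    exact zero_ne_one h8

/-- Tangent vectors along which a defining function increases point into `K`. -/
lemma IsDefiningAt.mem_posTangentConeAt {K : Set S3} {p : S3} {h : S3 → ℝ}
    (hd : IsDefiningAt K p h) (hp : h p = 0) {u : E4} (hu : ⟪(p : E4), u⟫ = 0)
    (hpos : 0 < ⟪sgrad h p, u⟫) : u ∈ posTangentConeAt ((↑) '' K : Set E4) (p : E4) := by
  set ℓ : ℝ → E4 := fun s => (p : E4) + s • u with hℓ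
  have hℓ0 : ℓ 0 = p := by simp [hℓ]
  have hℓd : HasDerivAt ℓ u 0 := by
    have h1 := ((hasDerivAt_id (0 : ℝ)).smul_const u).const_add (p : E4)
    rw [one_smul] at h1
    exact h1
  set γ : ℝ → E4 := fun s => (dir (ℓ s) : E4) with hγ
  have hγ0 : γ 0 = p := by simp [hγ, hℓ0]
  have hγd : HasDerivAt γ u 0 := by
    have h1 : HasFDerivAt ((fun x : S3 => (x : E4)) ∘ dir) (sderiv (fun x : S3 => (x : E4)) p)
        (ℓ 0) := by
      rw [hℓ0]; exact hasFDerivAt_sderiv contMDiff_coe p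
    have h2 := h1.comp_hasDerivAt (0 : ℝ) hℓd
    rw [sderiv_coe_apply, hu, zero_smul, sub_zero] at h2
    exact h2
  have hhd : HasDerivAt (fun s => h (dir (ℓ s))) ⟪sgrad h p, u⟫ 0 := by
    have h1 : HasFDerivAt (h ∘ dir) (sderiv h p) (ℓ 0) := by
      rw [hℓ0]; exact hasFDerivAt_sderiv hd.smooth p
    rw [inner_sgrad]
    exact h1.comp_hasDerivAt (0 : ℝ) hℓd
  have hslope : Tendsto (fun s => s⁻¹ • (γ s - p)) (𝓝[>] 0) (𝓝 u) := by
    have h1 := (hasDerivAt_iff_tendsto_slope_zero.1 hγd).mono_left (nhdsGT_le_nhdsNE (0 : ℝ))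
    simpa [hγ0] using h1
  have hslopeh : Tendsto (fun s => s⁻¹ • h (dir (ℓ s))) (𝓝[>] 0) (𝓝 ⟪sgrad h p, u⟫) := by
    have h1 := (hasDerivAt_iff_tendsto_slope_zero.1 hhd).mono_left (nhdsGT_le_nhdsNE (0 : ℝ))
    simpa [hℓ0, hp] using h1
  have hdir : Tendsto (fun s => dir (ℓ s)) (𝓝[>] 0) (𝓝 p) := by
    have h1 : ContinuousAt dir (ℓ 0) := by
      rw [hℓ0]; exact continuousAt_dir (coe_S3_ne_zero p)
    have h2 := h1.comp hℓd.continuousAt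
    rw [ContinuousAt, Function.comp_apply, hℓ0, dir_coe] at h2
    exact h2.mono_left nhdsWithin_le_nhds
  -- The cone is realised by the curve `s ↦ dir (p + s u)` with scale `1 / s`. The curve is in `K`
  -- for small `s > 0` because `h` has positive slope along it.
  refine mem_tangentConeAt_of_seq (𝓝[>] (0 : ℝ)) (fun s => Real.toNNReal s⁻¹)
    (fun s => γ s - p) ?_ ?_ ?_
  · have h1 : Tendsto γ (𝓝[>] 0) (𝓝 (γ 0)) := hγd.continuousAt.mono_left nhdsWithin_le_nhds
    rw [hγ0] at h1
    simpa using h1.sub_const (p : E4)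
  · filter_upwards [hdir.eventually hd.mem_iff, hslopeh.eventually (lt_mem_nhds hpos),
      self_mem_nhdsWithin] with s h1 h2 h3
    have h3' : (0 : ℝ) < s := h3
    rw [add_sub_cancel]
    refine ⟨dir (ℓ s), h1.2 ?_, rfl⟩
    rw [smul_eq_mul] at h2
    exact (pos_of_mul_pos_right h2 (inv_pos.2 h3').le).le
  · refine hslope.congr' ?_
    filter_upwards [self_mem_nhdsWithin] with s (hs : 0 < s)
    rw [NNReal.smul_def, Real.coe_toNNReal _ (inv_pos.2 hs).le]

/-- The outward conormal is the normalized negative gradient of a defining function. -/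
lemma IsOutwardConormal.eq_sgrad {K : Set S3} {p : S3} {h : S3 → ℝ} {w : E4}
    (hw : IsOutwardConormal K p w) (hd : IsDefiningAt K p h) (hp : h p = 0) :
    w = -(‖sgrad h p‖⁻¹ • sgrad h p) := by
  set g := sgrad h p with hg
  have hg0 : 0 < ‖g‖ := norm_pos_iff.2 hd.sgrad_ne
  have hgg : ⟪g, g⟫ = ‖g‖ ^ 2 := real_inner_self_eq_norm_sq g
  have hpg : ⟪(p : E4), g⟫ = 0 := inner_coe_sgrad hd.smooth p
  have hle : ∀ u : E4, ⟪(p : E4), u⟫ = 0 → 0 < ⟪g, u⟫ → ⟪w, u⟫ ≤ 0 := fun u h1 h2 =>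
    hw.outward u (hd.mem_posTangentConeAt hp h1 h2)
  set a := ⟪g, w⟫ / ‖g‖ ^ 2 with ha
  set z := w - a • g with hz
  have hgz : ⟪g, z⟫ = 0 := by
    rw [hz, inner_sub_right, real_inner_smul_right, hgg, ha]
    field_simp
    ring
  have hpz : ⟪(p : E4), z⟫ = 0 := by
    rw [hz, inner_sub_right, real_inner_smul_right, hpg, hw.tangent]; simp
  have hwz : ⟪w, z⟫ = ‖z‖ ^ 2 := by
    rw [← real_inner_self_eq_norm_sq]
    conv_rhs => rw [hz, inner_sub_left, ← hz, real_inner_smul_left, hgz]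
    simp
  -- Here `z` is the part of `w` orthogonal to `g`. For every `ε > 0` the vector `z + ε g` points
  -- into `K`, so its product with `w` is nonpositive; let `ε → 0`.
  have hz0 : ‖z‖ ^ 2 ≤ 0 := by
    have hlim : Tendsto (fun ε : ℝ => ‖z‖ ^ 2 + ε * ⟪w, g⟫) (𝓝[>] 0) (𝓝 (‖z‖ ^ 2)) := by
      have : Continuous fun ε : ℝ => ‖z‖ ^ 2 + ε * ⟪w, g⟫ := by fun_prop
      have h1 := this.tendsto 0
      simp only [zero_mul, add_zero] at h1
      exact h1.mono_left nhdsWithin_le_nhds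
    refine le_of_tendsto hlim ?_
    filter_upwards [self_mem_nhdsWithin] with ε (hε : 0 < ε)
    have h1 := hle (z + ε • g) (by rw [inner_add_right, real_inner_smul_right, hpz, hpg]; simp)
      (by rw [inner_add_right, real_inner_smul_right, hgz, hgg]; positivity)
    rwa [inner_add_right, real_inner_smul_right, hwz] at h1
  have hz1 : z = 0 := by
    have : ‖z‖ ^ 2 = 0 := le_antisymm hz0 (by positivity)
    simpa using this
  have hwa : w = a • g := sub_eq_zero.1 hz1
  have ha0 : a ≤ 0 := by
    have h1 := hle g hpg (by rw [hgg]; positivity)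
    rw [hwa, real_inner_smul_left, hgg] at h1
    by_contra h2
    push Not at h2
    have : 0 < a * ‖g‖ ^ 2 := by positivity
    linarith
  have ha1 : a = -‖g‖⁻¹ := by
    have h1 := hw.unit
    rw [hwa, norm_smul, Real.norm_of_nonpos ha0] at h1
    field_simp
    linarith
  rw [hwa, ha1, neg_smul]

lemma sgrad_const_mul {h : S3 → ℝ} (hh : ContMDiff (𝓡 3) 𝓘(ℝ, ℝ) ∞ h) (c : ℝ) (x : S3) :
    sgrad (fun y => c * h y) x = c • sgrad h x := by
  have h1 : sderiv (fun y => c * h y) x = c • sderiv h x :=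
    ((hasFDerivAt_sderiv hh x).const_mul c).fderiv
  rw [sgrad, h1, map_smul, sgrad]

/-- There is a defining function whose gradient at `p` is the inward unit conormal. -/
lemma IsDomain3.exists_normalized {K : Set S3} (hK : IsDomain3 K) {η : S3 → E4} {p : S3}
    (hp : p ∈ frontier K) (hη : IsOutwardConormal K p (η p)) :
    ∃ h, IsDefiningAt K p h ∧ sgrad h p = -η p := by
  obtain ⟨h, hd⟩ := hK.exists_isDefiningAt hp
  have h0 := hd.eq_zero hK.isCompact.isClosed hp
  have hg0 : 0 < ‖sgrad h p‖⁻¹ := inv_pos.2 (norm_pos_iff.2 hd.sgrad_ne)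
  refine ⟨fun y => ‖sgrad h p‖⁻¹ * h y, ⟨contMDiff_const.mul hd.smooth, ?_, ?_⟩, ?_⟩
  · filter_upwards [hd.mem_iff] with y hy
    rw [hy, mul_nonneg_iff_of_pos_left hg0]
  · rw [sgrad_const_mul hd.smooth]
    exact smul_ne_zero hg0.ne' hd.sgrad_ne
  · rw [sgrad_const_mul hd.smooth, hη.eq_sgrad hd h0, neg_neg]

/-- The outward conormal depends continuously on the boundary point. -/
lemma IsDomain3.continuousOn_conormal {K : Set S3} (hK : IsDomain3 K) {η : S3 → E4}
    (hη : ∀ p ∈ frontier K, IsOutwardConormal K p (η p)) : ContinuousOn η (frontier K) := by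
  intro p hp
  obtain ⟨h, hd⟩ := hK.exists_isDefiningAt hp
  have hc : ContinuousAt (fun q => -(‖sgrad h q‖⁻¹ • sgrad h q)) p := by
    have h1 := (continuous_sgrad hd.smooth).continuousAt (x := p)
    exact ((h1.norm.inv₀ (norm_ne_zero_iff.2 hd.sgrad_ne)).smul h1).neg
  refine hc.continuousWithinAt.congr_of_eventuallyEq ?_ ?_
  · filter_upwards [nhdsWithin_le_nhds hd.eventually, self_mem_nhdsWithin] with q h1 h2
    exact (hη q h2).eq_sgrad h1 (h1.eq_zero hK.isCompact.isClosed h2)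
  · exact (hη p hp).eq_sgrad hd (hd.eq_zero hK.isCompact.isClosed hp)

/-! ### Comparison of measures under almost isometric maps -/

section Hausdorff

open scoped NNReal ENNReal

variable {X Y : Type*} [EMetricSpace X] [MeasurableSpace X] [BorelSpace X]
  [EMetricSpace Y] [MeasurableSpace Y] [BorelSpace Y]

lemma euclideanHausdorffMeasure_image_le {f : X → Y} {s : Set X} {C : ℝ≥0}
    (hf : LipschitzOnWith C f s) (d : ℕ) : μHE[d] (f '' s) ≤ (C : ℝ≥0∞) ^ d * μHE[d] s := by
  have h := hf.hausdorffMeasure_image_le (d := (d : ℝ)) (by positivity)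
  rw [ENNReal.rpow_natCast] at h
  simp only [Measure.euclideanHausdorffMeasure_def, Measure.smul_apply, ENNReal.smul_def,
    smul_eq_mul]
  rw [mul_left_comm]
  gcongr

/-- The hypothesis makes `f` injective on `s` with a `C`-Lipschitz inverse on the image. -/
lemma euclideanHausdorffMeasure_le_image {f : X → Y} {s : Set X} {C : ℝ≥0}
    (hf : ∀ x ∈ s, ∀ y ∈ s, edist x y ≤ C * edist (f x) (f y)) (d : ℕ) :
    μHE[d] s ≤ (C : ℝ≥0∞) ^ d * μHE[d] (f '' s) := by
  rcases s.eq_empty_or_nonempty with rfl | ⟨x₀, hx₀⟩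
  · simp
  have hne : Nonempty X := ⟨x₀⟩
  have hinj : InjOn f s := fun x hx y hy hxy => by
    have h := hf x hx y hy
    rw [hxy, edist_self, mul_zero] at h
    exact edist_le_zero.1 h
  have hl : LipschitzOnWith C (Function.invFunOn f s) (f '' s) := by
    rintro _ ⟨x, hx, rfl⟩ _ ⟨y, hy, rfl⟩
    rw [hinj.leftInvOn_invFunOn hx, hinj.leftInvOn_invFunOn hy]
    exact hf x hx y hy
  have h := euclideanHausdorffMeasure_image_le hl d
  rwa [hinj.invFunOn_image Subset.rfl] at h

end Hausdorff

section Compare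

open scoped NNReal ENNReal

variable {X Y : Type*} [MeasurableSpace X] [MeasurableSpace Y] {μ : Measure X} {ν : Measure Y}

/-- The two set estimates compare the push-forward of `μ` restricted to `U` with `ν` from above, and
with `ν` restricted to `f '' U` from below. Integrals of nonnegative functions inherit both bounds.
-/
lemma integral_compare {f : X → Y} (hf : Measurable f) {U : Set X} (hU : MeasurableSet U) {C : ℝ≥0}
    (hle : ∀ A ⊆ U, MeasurableSet A → μ A ≤ C * ν (f '' A))
    (hge : ∀ A ⊆ U, MeasurableSet A → ν (f '' A) ≤ C * μ A)
    {F : Y → ℝ} (hF : ∀ y, 0 ≤ F y) (hFi : Integrable F ν) (hF0 : ∀ y ∉ f '' U, F y = 0) :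
    IntegrableOn (F ∘ f) U μ ∧ ∫ x in U, F (f x) ∂μ ≤ C * ∫ y, F y ∂ν ∧
      ∫ y, F y ∂ν ≤ C * ∫ x in U, F (f x) ∂μ := by
  set m := (μ.restrict U).map f with hm
  have hmB : ∀ B, MeasurableSet B → m B = μ (U ∩ f ⁻¹' B) := fun B hB => by
    rw [hm, Measure.map_apply hf hB, Measure.restrict_apply (hf hB), inter_comm]
  have h1 : m ≤ C • ν := by
    refine Measure.le_iff.2 fun B hB => ?_
    rw [hmB B hB]
    refine (hle _ inter_subset_left (hU.inter (hf hB))).trans ?_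
    rw [Measure.smul_apply, ENNReal.smul_def, smul_eq_mul]
    gcongr
    rintro _ ⟨x, hx, rfl⟩
    exact hx.2
  have h2 : ν.restrict (f '' U) ≤ C • m := by
    refine Measure.le_iff.2 fun B hB => ?_
    rw [Measure.restrict_apply hB, Measure.smul_apply, hmB B hB, ENNReal.smul_def, smul_eq_mul]
    have h3 : B ∩ f '' U = f '' (U ∩ f ⁻¹' B) := by
      rw [image_inter_preimage, inter_comm]
    rw [h3]
    exact hge _ inter_subset_left (hU.inter (hf hB))
  have hi : Integrable F (C • ν) := hFi.smul_measure ENNReal.coe_ne_top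
  have him : Integrable F m := hi.mono_measure h1
  have hmap : ∫ y, F y ∂m = ∫ x in U, F (f x) ∂μ :=
    integral_map hf.aemeasurable him.aestronglyMeasurable
  have hsmul : ∀ ρ : Measure Y, ∫ y, F y ∂(C • ρ) = C * ∫ y, F y ∂ρ := fun ρ => by
    rw [integral_smul_nnreal_measure, NNReal.smul_def, smul_eq_mul]
  refine ⟨(integrable_map_measure him.aestronglyMeasurable hf.aemeasurable).1 him, ?_, ?_⟩
  · rw [← hmap, ← hsmul]
    exact integral_mono_measure h1 (.of_forall hF) hi
  · rw [← hmap, ← hsmul, ← setIntegral_eq_integral_of_forall_compl_eq_zero hF0]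
    exact integral_mono_measure h2 (.of_forall hF) (him.smul_measure ENNReal.coe_ne_top)

end Compare

/-! ### Smoothed step functions -/

/-- A smooth step that vanishes on `(-∞, -1]` and is one on `[0, ∞)`. -/
noncomputable def ramp (s : ℝ) : ℝ := Real.smoothTransition (s + 1)

lemma contDiff_ramp : ContDiff ℝ ∞ ramp :=
  Real.smoothTransition.contDiff.comp (contDiff_id.add contDiff_const)

lemma ramp_of_nonneg {s : ℝ} (hs : 0 ≤ s) : ramp s = 1 :=
  Real.smoothTransition.one_of_one_le (by linarith)

lemma ramp_of_le {s : ℝ} (hs : s ≤ -1) : ramp s = 0 :=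
  Real.smoothTransition.zero_of_nonpos (by linarith)

lemma ramp_nonneg (s : ℝ) : 0 ≤ ramp s := Real.smoothTransition.nonneg _

lemma ramp_le_one (s : ℝ) : ramp s ≤ 1 := Real.smoothTransition.le_one _

lemma hasDerivAt_ramp (s : ℝ) : HasDerivAt ramp (deriv ramp s) s :=
  ((contDiff_ramp.differentiable (by simp)) s).hasDerivAt

lemma continuous_deriv_ramp : Continuous (deriv ramp) :=
  contDiff_ramp.continuous_deriv (by simp)

lemma deriv_ramp_nonneg (s : ℝ) : 0 ≤ deriv ramp s := by
  have h : Monotone ramp := fun a b hab => Real.smoothTransition.monotone (by linarith)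
  exact h.deriv_nonneg

lemma deriv_ramp_eq_zero {s : ℝ} (hs : s ∉ Icc (-1 : ℝ) 0) : deriv ramp s = 0 := by
  rw [mem_Icc, not_and_or, not_le, not_le] at hs
  rcases hs with hs | hs
  · have : ramp =ᶠ[𝓝 s] fun _ => 0 := by
      filter_upwards [gt_mem_nhds hs] with r hr using ramp_of_le hr.le
    rw [this.deriv_eq, deriv_const]
  · have : ramp =ᶠ[𝓝 s] fun _ => 1 := by
      filter_upwards [lt_mem_nhds hs] with r hr using ramp_of_nonneg hr.le
    rw [this.deriv_eq, deriv_const]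

lemma hasCompactSupport_deriv_ramp : HasCompactSupport (deriv ramp) :=
  HasCompactSupport.intro isCompact_Icc fun _ hs => deriv_ramp_eq_zero hs

lemma integral_deriv_ramp : ∫ s, deriv ramp s = 1 := by
  have h := integral_of_hasDerivAt_of_tendsto (m := (0 : ℝ)) (n := 1) hasDerivAt_ramp
    (continuous_deriv_ramp.integrable_of_hasCompactSupport hasCompactSupport_deriv_ramp)
    (tendsto_const_nhds.congr' (by
      filter_upwards [eventually_le_atBot (-1 : ℝ)] with s hs using (ramp_of_le hs).symm))
    (tendsto_const_nhds.congr' (by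
      filter_upwards [eventually_ge_atTop (0 : ℝ)] with s hs using (ramp_of_nonneg hs).symm))
  simpa using h

/-- The Euclidean plane. -/
abbrev E2 : Type := EuclideanSpace ℝ (Fin 2)

/-- A concentrating weight in the first variable picks out the slice over zero. -/
lemma tendsto_integral_ramp {g : ℝ × E2 → ℝ} (hg : Continuous g) (hs : HasCompactSupport g) :
    Tendsto (fun c : ℝ => ∫ q : ℝ × E2, c * deriv ramp (c * -q.1) * g q) atTop
      (𝓝 (∫ z : E2, g (0, z))) := by
  have hgi : Integrable g := hg.integrable_of_hasCompactSupport hs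
  set S : Set E2 := Prod.snd '' tsupport g with hS
  have hSc : IsCompact S := hs.isCompact.image continuous_snd
  have hG0 : ∀ β z, z ∉ S → g (β, z) = 0 := fun β z hz =>
    image_eq_zero_of_notMem_tsupport fun h => hz ⟨_, h, rfl⟩
  have hGc : Continuous fun β : ℝ => ∫ z : E2, g (β, z) := by
    have h1 : (fun β : ℝ => ∫ z : E2, g (β, z)) = fun β => ∫ z in S, g (β, z) := by
      ext1 β
      exact (setIntegral_eq_integral_of_forall_compl_eq_zero fun z hz => hG0 β z hz).symm
    rw [h1]
    exact continuous_parametric_integral_of_continuous (f := fun β z => g (β, z))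
      (by simpa [Function.uncurry_def] using hg) hSc
  have hGi : Integrable fun β : ℝ => ∫ z : E2, g (β, z) := hgi.integral_prod_left
  have hk : ∫ s, deriv ramp (-s) = 1 := by
    rw [integral_neg_eq_self (fun s => deriv ramp s), integral_deriv_ramp]
  have hlim : Tendsto (fun x : ℝ ↦ ‖x‖ ^ Module.finrank ℝ ℝ * deriv ramp (-x))
      (Bornology.cobounded ℝ) (𝓝 0) := by
    refine tendsto_const_nhds.congr' ?_
    have : {x : ℝ | x ∉ Icc (0 : ℝ) 1} ∈ Bornology.cobounded ℝ :=
      (isBounded_Icc (0 : ℝ) 1)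
    filter_upwards [this] with x hx
    rw [deriv_ramp_eq_zero fun h => hx ⟨by linarith [h.2], by linarith [h.1]⟩, mul_zero]
  -- The function `deriv ramp (-s)` is a nonnegative bump of mass one supported in `[0, 1]`. Its
  -- rescalings form an approximate identity, applied to the slice integrals of `g`.
  have h := tendsto_integral_comp_smul_smul_of_integrable (μ := (volume : Measure ℝ))
    (φ := fun s => deriv ramp (-s)) (fun s => deriv_ramp_nonneg _) hk hlim hGi hGc.continuousAt
  refine h.congr fun c => ?_
  have hint : Integrable fun q : ℝ × E2 => c * deriv ramp (c * -q.1) * g q := by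
    refine Continuous.integrable_of_hasCompactSupport ?_ hs.mul_left
    have := continuous_deriv_ramp
    fun_prop
  rw [Measure.volume_eq_prod, integral_prod _ hint]
  refine integral_congr_ae (.of_forall fun β => ?_)
  simp [integral_const_mul]

/-! ### A chart that straightens the boundary -/

section Frame

variable (b : OrthonormalBasis (Fin 4) ℝ E4)

/-- The coordinates of an orthonormal frame, grouped as `ℝ × ℝ × ℝ²`. -/
noncomputable def frame (q : ℝ × ℝ × E2) : E4 :=
  q.1 • b 0 + q.2.1 • b 1 + q.2.2 0 • b 2 + q.2.2 1 • b 3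

lemma measurePreserving_frame : MeasurePreserving (frame b) := by
  have h1 : MeasurePreserving (Prod.map id (Prod.map id (WithLp.ofLp (p := 2))) :
      ℝ × ℝ × E2 → ℝ × ℝ × (Fin 2 → ℝ)) :=
    (MeasurePreserving.id volume).prod
      ((MeasurePreserving.id volume).prod (PiLp.volume_preserving_ofLp (Fin 2)))
  have h2 : MeasurePreserving (Prod.map id
      (MeasurableEquiv.piFinSuccAbove (fun _ : Fin 3 => ℝ) 0).symm :
      ℝ × ℝ × (Fin 2 → ℝ) → ℝ × (Fin 3 → ℝ)) :=
    (MeasurePreserving.id volume).prod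
      (volume_preserving_piFinSuccAbove (fun _ : Fin 3 => ℝ) 0).symm
  have h3 := (volume_preserving_piFinSuccAbove (fun _ : Fin 4 => ℝ) 0).symm
  have h4 := PiLp.volume_preserving_toLp (Fin 4)
  have h5 := b.measurePreserving_repr_symm
  have h := h5.comp (h4.comp (h3.comp (h2.comp h1)))
  have heq : frame b = b.repr.symm ∘ (WithLp.toLp 2 ∘
      ((MeasurableEquiv.piFinSuccAbove (fun _ : Fin 4 => ℝ) 0).symm ∘
        (Prod.map id (MeasurableEquiv.piFinSuccAbove (fun _ : Fin 3 => ℝ) 0).symm ∘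
          Prod.map id (Prod.map id (WithLp.ofLp (p := 2)))))) := by
    funext q
    obtain ⟨r, β, z⟩ := q
    rw [frame, Function.comp_apply, ← b.sum_repr_symm]
    simp [Fin.sum_univ_four, MeasurableEquiv.piFinSuccAbove, Fin.insertNthEquiv]
    rfl
  rw [heq]
  exact h

lemma inner_frame (q : ℝ × ℝ × E2) : ⟪b 0, frame b q⟫ = q.1 ∧ ⟪b 1, frame b q⟫ = q.2.1 ∧
    ⟪b 2, frame b q⟫ = q.2.2 0 ∧ ⟪b 3, frame b q⟫ = q.2.2 1 := by
  simp [frame, inner_add_right, real_inner_smul_right, b.inner_eq_ite]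

lemma frame_injective : Function.Injective (frame b) := by
  intro q q' hqq
  obtain ⟨h0, h1, h2, h3⟩ := inner_frame b q
  obtain ⟨h0', h1', h2', h3'⟩ := inner_frame b q'
  rw [hqq] at h0 h1 h2 h3
  refine Prod.ext (h0.symm.trans h0') (Prod.ext (h1.symm.trans h1') ?_)
  ext i
  fin_cases i
  · exact h2.symm.trans h2'
  · exact h3.symm.trans h3'

lemma continuous_frame : Continuous (frame b) := by
  unfold frame; fun_prop

lemma frame_smul (r : ℝ) (q : ℝ × ℝ × E2) : frame b (r • q) = r • frame b q := by
  simp [frame, smul_smul, smul_add]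

lemma norm_frame_sub (r β : ℝ) (z z' : E2) :
    ‖frame b (r, β, z) - frame b (r, β, z')‖ = ‖z - z'‖ := by
  have h : frame b (r, β, z) - frame b (r, β, z') =
      (z 0 - z' 0) • b 2 + (z 1 - z' 1) • b 3 := by
    simp only [frame]; module
  have h2 : ‖frame b (r, β, z) - frame b (r, β, z')‖ ^ 2 = ‖z - z'‖ ^ 2 := by
    have h3 : ‖z - z'‖ ^ 2 = (z 0 - z' 0) ^ 2 + (z 1 - z' 1) ^ 2 := by
      rw [EuclideanSpace.norm_sq_eq]; simp [Fin.sum_univ_two]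
    rw [h3, h, ← real_inner_self_eq_norm_sq]
    simp only [inner_add_left, inner_add_right, real_inner_smul_left, real_inner_smul_right,
      b.inner_eq_ite]
    simp
    ring
  exact (pow_left_inj₀ (norm_nonneg _) (norm_nonneg _) two_ne_zero).1 h2

open scoped ENNReal in
/-- The volume of the cone of height one over a set of the affine hyperplane `r = 1`. -/
lemma volume_frame_cone {S : Set (ℝ × E2)} (hS : MeasurableSet S) :
    volume (frame b '' {q | q.1 ∈ Ioo (0 : ℝ) 1 ∧ q.1⁻¹ • q.2 ∈ S}) =
      ENNReal.ofReal (1 / 4) * volume S := by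
  have hm : MeasurableSet {q : ℝ × ℝ × E2 | q.1 ∈ Ioo (0 : ℝ) 1 ∧ q.1⁻¹ • q.2 ∈ S} := by
    refine (measurable_fst measurableSet_Ioo).inter ?_
    have : Measurable fun q : ℝ × ℝ × E2 => q.1⁻¹ • q.2 := by fun_prop
    exact this hS
  have hHaar : (volume : Measure (ℝ × E2)).IsAddHaarMeasure := by
    rw [Measure.volume_eq_prod]; infer_instance
  have hemb : MeasurableEmbedding (frame b) :=
    (continuous_frame b).measurableEmbedding (frame_injective b)
  rw [← (measurePreserving_frame b).measure_preimage_emb hemb,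
    (frame_injective b).preimage_image, Measure.volume_eq_prod, Measure.prod_apply hm]
  -- The slice at height `r` is `r • S` in dimension three.
  have h1 : ∀ r : ℝ, volume (Prod.mk r ⁻¹' {q : ℝ × ℝ × E2 |
      q.1 ∈ Ioo (0 : ℝ) 1 ∧ q.1⁻¹ • q.2 ∈ S}) =
      (Ioo (0 : ℝ) 1).indicator (fun r => ENNReal.ofReal (r ^ 3) * volume S) r := by
    intro r
    by_cases hr : r ∈ Ioo (0 : ℝ) 1
    · have h2 : Prod.mk r ⁻¹' {q : ℝ × ℝ × E2 | q.1 ∈ Ioo (0 : ℝ) 1 ∧ q.1⁻¹ • q.2 ∈ S} =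
          (r⁻¹ • ·) ⁻¹' S := by
        ext ζ; simp [hr.1, hr.2]
      have hr0 : (0 : ℝ) < r := hr.1
      rw [h2, Measure.addHaar_preimage_smul _ (inv_ne_zero hr0.ne'), indicator_of_mem hr]
      have h3 : Module.finrank ℝ (ℝ × E2) = 3 := by simp
      rw [h3, inv_pow, inv_inv, abs_of_pos (by positivity)]
    · have h2 : Prod.mk r ⁻¹' {q : ℝ × ℝ × E2 | q.1 ∈ Ioo (0 : ℝ) 1 ∧ q.1⁻¹ • q.2 ∈ S} = ∅ := by
        ext ζ
        simp only [mem_preimage, mem_ofPred_eq, hr, false_and, mem_empty_iff_false]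
      rw [h2, indicator_of_notMem hr, measure_empty]
  simp_rw [h1]
  rw [lintegral_indicator measurableSet_Ioo, lintegral_mul_const _ (by fun_prop)]
  congr 1
  rw [← ofReal_integral_eq_lintegral_ofReal]
  · congr 1
    rw [← integral_Ioc_eq_integral_Ioo, ← intervalIntegral.integral_of_le zero_le_one, integral_pow]
    norm_num
  · exact ((continuous_id.pow 3).integrableOn_Icc (a := (0 : ℝ)) (b := 1)).mono_set
      Ioo_subset_Icc_self
  · filter_upwards [ae_restrict_mem measurableSet_Ioo] with r hr
    have : (0 : ℝ) < r := hr.1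
    exact pow_nonneg this.le 3

end Frame

open scoped NNReal ENNReal

section Flat

variable (b : OrthonormalBasis (Fin 4) ℝ E4) (h : S3 → ℝ)

/-- The last two coordinates of a point of the sphere. -/
noncomputable def planar (x : S3) : E2 := !₂[⟪b 2, (x : E4)⟫, ⟪b 3, (x : E4)⟫]

/-- The chart that uses a function and the last two coordinates. -/
noncomputable def flat (x : S3) : ℝ × E2 := (-h x, planar b x)

/-- The degree one homogeneous extension of the chart. -/
noncomputable def flatCone (y : E4) : E4 := ‖y‖ • frame b (1, flat b h (dir y))

variable {b h}

lemma continuous_planar : Continuous (planar b) := by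
  unfold planar
  refine (PiLp.continuous_toLp 2 _).comp (continuous_pi fun i => ?_)
  fin_cases i <;> simp <;> fun_prop

lemma continuous_flat (hh : Continuous h) : Continuous (flat b h) :=
  hh.neg.prodMk continuous_planar

lemma frame_flat (x : S3) : frame b (1, flat b h x) =
    b 0 + (-h x) • b 1 + ⟪b 2, (x : E4)⟫ • b 2 + ⟪b 3, (x : E4)⟫ • b 3 := by
  simp [frame, flat, planar]

lemma contMDiff_frame_flat (hh : ContMDiff (𝓡 3) 𝓘(ℝ, ℝ) ∞ h) :
    ContMDiff (𝓡 3) 𝓘(ℝ, E4) ∞ fun x => frame b (1, flat b h x) := by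
  simp_rw [frame_flat]
  have h2 : ∀ i, ContMDiff (𝓡 3) 𝓘(ℝ, ℝ) ∞ fun x : S3 => ⟪b i, (x : E4)⟫ := fun i =>
    (innerSL ℝ (b i)).contDiff.contMDiff.comp contMDiff_coe
  exact ((contMDiff_const.add (hh.neg.smul contMDiff_const)).add
    ((h2 2).smul contMDiff_const)).add ((h2 3).smul contMDiff_const)

/-- The normalisation `sgrad h p = -b 1` makes `-h` agree to first order with the coordinate along
`b 1`. The other coordinates are linear in the position, so the chart distorts distances little near
`p`. -/
lemma homDeriv_frame_flat (hh : ContMDiff (𝓡 3) 𝓘(ℝ, ℝ) ∞ h) {p : S3} (hp : h p = 0)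
    (hb : b 0 = p) (hg : sgrad h p = -b 1) :
    homDeriv (fun x => frame b (1, flat b h x)) p = ContinuousLinearMap.id ℝ E4 := by
  have hi : ∀ i, HasFDerivAt (fun y => ⟪b i, (dir y : E4)⟫)
      ((innerSL ℝ (b i)).comp (sderiv (fun x : S3 => (x : E4)) p)) (p : E4) := fun i =>
    (innerSL ℝ (b i)).hasFDerivAt.comp (p : E4) (hasFDerivAt_sderiv contMDiff_coe p)
  have h1 := ((((hasFDerivAt_const (b 0) (p : E4)).fun_add
    ((hasFDerivAt_sderiv hh p).fun_neg.smul_const (b 1))).fun_add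
    ((hi 2).smul_const (b 2))).fun_add ((hi 3).smul_const (b 3)))
  have hfun : (fun x => frame b (1, flat b h x)) ∘ dir = fun y =>
      b 0 + (-(h ∘ dir) y) • b 1 + ⟪b 2, (dir y : E4)⟫ • b 2 + ⟪b 3, (dir y : E4)⟫ • b 3 :=
    funext fun y => frame_flat (dir y)
  rw [← hfun] at h1
  have h2 : sderiv (fun x => frame b (1, flat b h x)) p = _ := h1.fderiv
  have hW : frame b (1, flat b h p) = b 0 := by
    rw [frame_flat, hp, ← hb]
    simp [b.inner_eq_ite]
  ext1 u
  have h3 : sderiv h p u = -⟪b 1, u⟫ := by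
    rw [← inner_sgrad, hg, inner_neg_left]
  have h4 : ∀ i, i ≠ 0 → ⟪b i, u - ⟪b 0, u⟫ • b 0⟫ = ⟪b i, u⟫ := fun i hi' => by
    rw [inner_sub_right, real_inner_smul_right, b.inner_eq_zero hi']; simp
  rw [homDeriv, h2, hW]
  simp only [add_apply, ContinuousLinearMap.smulRight_apply, ContinuousLinearMap.comp_apply,
    neg_apply, h3, sderiv_coe_apply, innerSL_apply_apply, h4 2 (by decide), h4 3 (by decide),
    ContinuousLinearMap.id_apply, zero_apply, ← hb]
  conv_rhs => rw [← b.sum_repr' u, Fin.sum_univ_four]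
  module

lemma hasFDerivAt_flatCone (hh : ContMDiff (𝓡 3) 𝓘(ℝ, ℝ) ∞ h) {y : E4} (hy : y ≠ 0) :
    HasFDerivAt (flatCone b h) (homDeriv (fun x => frame b (1, flat b h x)) (dir y)) y :=
  hasFDerivAt_hom (contMDiff_frame_flat hh) hy

/-- The infinite open cone over a subset of the sphere. -/
def fullCone (U : Set S3) : Set E4 := {y | y ≠ 0 ∧ dir y ∈ U}

lemma isOpen_fullCone {U : Set S3} (hU : IsOpen U) : IsOpen (fullCone U) := by
  rw [isOpen_iff_mem_nhds]
  rintro y ⟨hy, hyU⟩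
  filter_upwards [isOpen_ne.mem_nhds hy, continuousAt_dir hy (hU.mem_nhds hyU)] with z h1 h2
  exact ⟨h1, h2⟩

/-- Near `p` the homogeneous chart is close to the identity. -/
lemma exists_approximatesLinearOn (hh : ContMDiff (𝓡 3) 𝓘(ℝ, ℝ) ∞ h) {p : S3} (hp : h p = 0)
    (hb : b 0 = p) (hg : sgrad h p = -b 1) {ε : ℝ≥0} (hε : 0 < ε) {N : Set S3} (hN : N ∈ 𝓝 p) :
    ∃ U : Set S3, IsOpen U ∧ p ∈ U ∧ U ⊆ N ∧
      ApproximatesLinearOn (flatCone b h) (ContinuousLinearMap.id ℝ E4) (fullCone U) ε := by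
  have hc := continuous_homDeriv (contMDiff_frame_flat (b := b) hh)
  have h1 : ∀ᶠ x in 𝓝 p, ‖homDeriv (fun x => frame b (1, flat b h x)) x -
      ContinuousLinearMap.id ℝ E4‖ < ε := by
    have h2 : Continuous fun x => ‖homDeriv (fun x => frame b (1, flat b h x)) x -
      ContinuousLinearMap.id ℝ E4‖ := (hc.sub continuous_const).norm
    refine h2.continuousAt.eventually (gt_mem_nhds ?_)
    simp only [homDeriv_frame_flat hh hp hb hg]
    simpa using hε
  obtain ⟨ρ, hρ, hball⟩ := Metric.mem_nhds_iff.1 (h1.and hN)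
  -- The neighbourhood is the cap `‖x - p‖ < ρ'`, which is `⟪p, x⟫ > 1 - ρ'² / 2`. Taking `ρ' ≤ 1`
  -- keeps this constant nonnegative, so the cone over the cap is convex and the mean value
  -- inequality applies on it.
  set ρ' := min ρ 1 with hρ'
  have hρ0 : 0 < ρ' := lt_min hρ one_pos
  have hρ1 : ρ' ≤ 1 := min_le_right _ _
  set α : ℝ := 1 - ρ' ^ 2 / 2 with hα
  have hα0 : 0 ≤ α := by rw [hα]; nlinarith
  set U : Set S3 := {x | α < ⟪(p : E4), (x : E4)⟫} with hU
  have hUball : U ⊆ ball p ρ := by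
    intro x hx
    have hx' : α < ⟪(p : E4), (x : E4)⟫ := hx
    have h3 : dist x p ^ 2 < ρ' ^ 2 := by
      rw [Subtype.dist_eq, dist_eq_norm, @norm_sub_sq ℝ]
      simp only [norm_coe_S3, RCLike.re_to_real, real_inner_comm]
      rw [hα] at hx'
      linarith
    exact (lt_of_pow_lt_pow_left₀ 2 hρ0.le h3).trans_le (min_le_left _ _)
  have hcone : fullCone U = {y : E4 | α * ‖y‖ < ⟪(p : E4), y⟫} := by
    ext y
    constructor
    · rintro ⟨hy, hyU⟩
      have hy0 := norm_pos_iff.2 hy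
      have h3 : α < ⟪(p : E4), (dir y : E4)⟫ := hyU
      rw [coe_dir hy, real_inner_smul_right] at h3
      have h4 := mul_lt_mul_of_pos_right h3 hy0
      rwa [mul_comm (‖y‖⁻¹), mul_assoc, inv_mul_cancel₀ hy0.ne', mul_one] at h4
    · intro h3
      have h3' : α * ‖y‖ < ⟪(p : E4), y⟫ := h3
      have hy : y ≠ 0 := by rintro rfl; simp at h3'
      have hy0 := norm_pos_iff.2 hy
      refine ⟨hy, ?_⟩
      change α < ⟪(p : E4), (dir y : E4)⟫
      rw [coe_dir hy, real_inner_smul_right, ← div_eq_inv_mul, lt_div_iff₀ hy0]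
      exact h3'
  have hconv : Convex ℝ (fullCone U) := by
    rw [hcone]
    have h3 : ConvexOn ℝ univ fun y : E4 => α * ‖y‖ - ⟪(p : E4), y⟫ :=
      ((convexOn_norm convex_univ).smul hα0).sub
        ((innerSL ℝ (p : E4)).toLinearMap.concaveOn convex_univ)
    have h4 := h3.convex_lt 0
    simpa [sub_neg] using h4
  refine ⟨U, isOpen_lt continuous_const (by fun_prop), ?_, fun x hx => (hball (hUball hx)).2, ?_⟩
  · change α < ⟪(p : E4), (p : E4)⟫
    rw [inner_self_S3, hα]
    nlinarith
  · refine ApproximatesLinearOn.approximatesLinearOn_iff_lipschitzOnWith.2 ?_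
    refine hconv.lipschitzOnWith_of_nnnorm_hasFDerivWithin_le
      (f' := fun y => homDeriv (fun x => frame b (1, flat b h x)) (dir y) -
        ContinuousLinearMap.id ℝ E4) (fun y hy => ?_) (fun y hy => ?_)
    · exact ((hasFDerivAt_flatCone hh hy.1).sub
        (ContinuousLinearMap.id ℝ E4).hasFDerivAt).hasFDerivWithinAt
    · exact (hball (hUball hy.2)).1.le

end Flat

/-- The chart `flat b h` is almost isometric on `U`, with distortion constant `M`. -/
structure IsAlmostIsometric (b : OrthonormalBasis (Fin 4) ℝ E4) (h : S3 → ℝ) (M : ℝ≥0)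
    (U : Set S3) : Prop where
  isOpen : IsOpen U
  continuous : Continuous h
  isOpen_image : ∀ O ⊆ fullCone U, IsOpen O → IsOpen (flatCone b h '' O)
  lipschitz : LipschitzOnWith M (flatCone b h) (fullCone U)
  antilipschitz : ∀ y ∈ fullCone U, ∀ z ∈ fullCone U,
    edist y z ≤ M * edist (flatCone b h y) (flatCone b h z)

lemma exists_isAlmostIsometric {b : OrthonormalBasis (Fin 4) ℝ E4} {h : S3 → ℝ}
    (hh : ContMDiff (𝓡 3) 𝓘(ℝ, ℝ) ∞ h) {p : S3} (hp : h p = 0)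
    (hb : b 0 = p) (hg : sgrad h p = -b 1) {M : ℝ≥0} (hM : 1 < M) {N : Set S3} (hN : N ∈ 𝓝 p) :
    ∃ U : Set S3, p ∈ U ∧ U ⊆ N ∧ IsAlmostIsometric b h M U := by
  have hM' : (1 : ℝ) < M := by exact_mod_cast hM
  have hM0 : (0 : ℝ) < M := by linarith
  have hε0 : (0 : ℝ) < 1 - (M : ℝ)⁻¹ := sub_pos.2 (inv_lt_one_of_one_lt₀ hM')
  -- With this choice `1 - ε = 1 / M` and `1 + ε ≤ M`, so both distance bounds have constant `M`.
  set ε : ℝ≥0 := ⟨1 - (M : ℝ)⁻¹, hε0.le⟩ with hε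
  have hεr : (ε : ℝ) = 1 - (M : ℝ)⁻¹ := rfl
  obtain ⟨U, hUo, hpU, hUN, hA⟩ := exists_approximatesLinearOn (b := b) hh hp hb hg
    (ε := ε) (by exact_mod_cast hε0) hN
  have h1ε : 1 + (ε : ℝ) ≤ M := by
    rw [hεr]
    have : (M : ℝ) * (M : ℝ)⁻¹ = 1 := mul_inv_cancel₀ hM0.ne'
    nlinarith [inv_pos.2 hM0]
  have hest : ∀ y ∈ fullCone U, ∀ z ∈ fullCone U,
      ‖flatCone b h y - flatCone b h z - (y - z)‖ ≤ ε * ‖y - z‖ := fun y hy z hz => by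
    simpa using hA y hy z hz
  refine ⟨U, hpU, hUN, hUo, hh.continuous, fun O hO hOo => ?_, ?_, ?_⟩
  · have hsub : ApproximatesLinearOn (flatCone b h)
        ((ContinuousLinearEquiv.refl ℝ E4 : E4 ≃L[ℝ] E4) : E4 →L[ℝ] E4) O ε := hA.mono_set hO
    refine hsub.open_image (ContinuousLinearEquiv.toNonlinearRightInverse _) hOo (Or.inr ?_)
    have h3 : (ContinuousLinearEquiv.refl ℝ E4).toNonlinearRightInverse.nnnorm = 1 := by
      change ‖((ContinuousLinearEquiv.refl ℝ E4).symm : E4 →L[ℝ] E4)‖₊ = 1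
      exact ContinuousLinearMap.nnnorm_id
    rw [h3, inv_one, ← NNReal.coe_lt_coe, hεr]
    have := inv_pos.2 hM0
    push_cast
    linarith
  · refine LipschitzOnWith.of_dist_le_mul fun y hy z hz => ?_
    rw [dist_eq_norm, dist_eq_norm]
    have h3 : ‖flatCone b h y - flatCone b h z‖ ≤
        ‖flatCone b h y - flatCone b h z - (y - z)‖ + ‖y - z‖ := by
      simpa using norm_add_le (flatCone b h y - flatCone b h z - (y - z)) (y - z)
    have h4 := hest y hy z hz
    nlinarith [norm_nonneg (y - z)]
  · intro y hy z hz
    rw [edist_dist, edist_dist, ← ENNReal.ofReal_coe_nnreal, ← ENNReal.ofReal_mul hM0.le]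
    refine ENNReal.ofReal_le_ofReal ?_
    rw [dist_eq_norm, dist_eq_norm]
    have h3 : ‖y - z‖ ≤
        ‖flatCone b h y - flatCone b h z‖ + ‖flatCone b h y - flatCone b h z - (y - z)‖ := by
      simpa using norm_sub_le (flatCone b h y - flatCone b h z)
        (flatCone b h y - flatCone b h z - (y - z))
    have h4 := hest y hy z hz
    rw [hεr] at h4
    have h5 : (M : ℝ)⁻¹ * ‖y - z‖ ≤ ‖flatCone b h y - flatCone b h z‖ := by linarith
    calc ‖y - z‖ = M * ((M : ℝ)⁻¹ * ‖y - z‖) := by field_simp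
      _ ≤ _ := by gcongr

/-! ### Distortion of volume and area in the chart -/

namespace IsAlmostIsometric

variable {b : OrthonormalBasis (Fin 4) ℝ E4} {h : S3 → ℝ} {M : ℝ≥0} {U : Set S3}

lemma coe_mem_fullCone {x : S3} (hx : x ∈ U) : (x : E4) ∈ fullCone U :=
  ⟨coe_S3_ne_zero x, by simpa using hx⟩

lemma flatCone_coe (x : S3) : flatCone b h (x : E4) = frame b (1, flat b h x) := by
  simp [flatCone]

lemma flatCone_eq {y : E4} : flatCone b h y = frame b (‖y‖, ‖y‖ • flat b h (dir y)) := by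
  rw [flatCone, ← frame_smul]
  simp

lemma injOn (H : IsAlmostIsometric b h M U) : InjOn (flat b h) U := by
  intro x hx y hy hxy
  have h1 := H.antilipschitz _ (coe_mem_fullCone hx) _ (coe_mem_fullCone hy)
  rw [flatCone_coe, flatCone_coe, hxy, edist_self, mul_zero] at h1
  exact Subtype.ext (edist_le_zero.1 h1)

/-- The image is the slice at height one of an open cone in `ℝ⁴`. -/
lemma isOpen_flat_image (H : IsAlmostIsometric b h M U) {O : Set S3} (hO : O ⊆ U)
    (hOo : IsOpen O) : IsOpen (flat b h '' O) := by
  have h1 := H.isOpen_image (fullCone O) (fun y hy => ⟨hy.1, hO hy.2⟩) (isOpen_fullCone hOo)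
  have h2 : flat b h '' O = (fun ζ => frame b (1, ζ)) ⁻¹' (flatCone b h '' fullCone O) := by
    ext ζ
    constructor
    · rintro ⟨x, hx, rfl⟩
      exact ⟨x, coe_mem_fullCone hx, flatCone_coe x⟩
    · rintro ⟨y, hy, hyζ⟩
      have hyζ' : flatCone b h y = frame b (1, ζ) := hyζ
      rw [flatCone_eq] at hyζ'
      have h3 := frame_injective b hyζ'
      simp only [Prod.mk.injEq] at h3
      refine ⟨dir y, hy.2, ?_⟩
      rw [← h3.2, h3.1, one_smul]
  rw [h2]
  exact h1.preimage ((continuous_frame b).comp (by fun_prop))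

lemma measurableSet_image (H : IsAlmostIsometric b h M U) {A : Set S3} (hA : A ⊆ U)
    (hAm : MeasurableSet A) : MeasurableSet (flat b h '' A) :=
  hAm.image_of_continuousOn_injOn (continuous_flat H.continuous).continuousOn (H.injOn.mono hA)

lemma flatCone_image (A : Set S3) : flatCone b h '' coneSet A =
    frame b '' {q | q.1 ∈ Ioo (0 : ℝ) 1 ∧ q.1⁻¹ • q.2 ∈ flat b h '' A} := by
  ext z
  constructor
  · rintro ⟨y, ⟨hy, hyA⟩, rfl⟩
    refine ⟨(‖y‖, ‖y‖ • flat b h (dir y)), ⟨hy, ?_⟩, flatCone_eq.symm⟩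
    have : ‖y‖⁻¹ • ‖y‖ • flat b h (dir y) = flat b h (dir y) := by
      rw [smul_smul, inv_mul_cancel₀ hy.1.ne', one_smul]
    simp only [this]
    exact mem_image_of_mem _ hyA
  · rintro ⟨⟨r, ζ⟩, ⟨hr, x, hx, hxζ⟩, rfl⟩
    have hr0 : (0 : ℝ) < r := hr.1
    simp only at hxζ
    have h1 : ‖r • (x : E4)‖ = r := by simp [norm_smul, abs_of_pos hr0]
    have h2 : dir (r • (x : E4)) = x := by rw [dir_smul hr0, dir_coe]
    refine ⟨r • (x : E4), ⟨by rwa [h1], by rwa [h2]⟩, ?_⟩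
    rw [flatCone_eq, h1, h2, hxζ, smul_smul, mul_inv_cancel₀ hr0.ne', one_smul]

/-- The measures on `S³` and on `ℝ × ℝ²` are both four times the volume of the cone of height one,
so they can be compared through maps of `ℝ⁴`. -/
lemma four_mul_volume (H : IsAlmostIsometric b h M U) {A : Set S3} (hA : A ⊆ U)
    (hAm : MeasurableSet A) :
    4 * volume (flatCone b h '' coneSet A) = volume (flat b h '' A) := by
  rw [flatCone_image, volume_frame_cone b (H.measurableSet_image hA hAm), ← mul_assoc]
  have : (4 : ℝ≥0∞) * ENNReal.ofReal (1 / 4) = 1 := by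
    rw [show (4 : ℝ≥0∞) = ENNReal.ofReal 4 by simp, ← ENNReal.ofReal_mul (by norm_num)]
    norm_num
  rw [this, one_mul]

lemma coneSet_subset {A : Set S3} (hA : A ⊆ U) : coneSet A ⊆ fullCone U :=
  fun _ hy => ⟨norm_pos_iff.1 hy.1.1, hA hy.2⟩

/-- The exponent is 4 because the Lipschitz bounds are applied to four-dimensional cones. -/
lemma vol3_le (H : IsAlmostIsometric b h M U) {A : Set S3} (hA : A ⊆ U)
    (hAm : MeasurableSet A) : vol3 A ≤ (M ^ 4 : ℝ≥0) * volume (flat b h '' A) := by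
  rw [← H.four_mul_volume hA hAm, vol3_apply hAm, mul_left_comm]
  gcongr
  have h1 := euclideanHausdorffMeasure_le_image (s := coneSet A) (f := flatCone b h) (C := M)
    (fun y hy z hz => H.antilipschitz y (coneSet_subset hA hy) z (coneSet_subset hA hz)) 4
  rw [EuclideanSpace.euclideanHausdorffMeasure_eq_volume] at h1
  simpa using h1

lemma le_vol3 (H : IsAlmostIsometric b h M U) {A : Set S3} (hA : A ⊆ U)
    (hAm : MeasurableSet A) : volume (flat b h '' A) ≤ (M ^ 4 : ℝ≥0) * vol3 A := by
  rw [← H.four_mul_volume hA hAm, vol3_apply hAm, mul_left_comm]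
  gcongr
  have h1 := euclideanHausdorffMeasure_image_le (H.lipschitz.mono (coneSet_subset hA)) 4
  rw [EuclideanSpace.euclideanHausdorffMeasure_eq_volume] at h1
  simpa using h1

/-- On the zero set of `h` the chart has only planar coordinates, so `planar` inherits its Lipschitz
bounds there. -/
lemma edist_planar {x y : S3} (hx : h x = 0) (hy : h y = 0) :
    edist (planar b x) (planar b y) = edist (flatCone b h (x : E4)) (flatCone b h (y : E4)) := by
  rw [edist_dist, edist_dist, dist_eq_norm, dist_eq_norm, flatCone_coe, flatCone_coe, flat, flat,
    hx, hy, norm_frame_sub]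

lemma area_le (H : IsAlmostIsometric b h M U) {A : Set S3} (hA : A ⊆ U) (hA0 : ∀ x ∈ A, h x = 0) :
    μHE[2] A ≤ (M ^ 2 : ℝ≥0) * volume (planar b '' A) := by
  have h1 := euclideanHausdorffMeasure_le_image (s := A) (f := planar b) (C := M)
    (fun x hx y hy => by
      rw [edist_planar (hA0 x hx) (hA0 y hy), Subtype.edist_eq]
      exact H.antilipschitz _ (coe_mem_fullCone (hA hx)) _ (coe_mem_fullCone (hA hy))) 2
  rw [EuclideanSpace.euclideanHausdorffMeasure_eq_volume] at h1
  simpa using h1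

lemma le_area (H : IsAlmostIsometric b h M U) {A : Set S3} (hA : A ⊆ U) (hA0 : ∀ x ∈ A, h x = 0) :
    volume (planar b '' A) ≤ (M ^ 2 : ℝ≥0) * μHE[2] A := by
  have h1 := euclideanHausdorffMeasure_image_le (s := A) (f := planar b) (C := M)
    (fun x hx y hy => by
      rw [edist_planar (hA0 x hx) (hA0 y hy), Subtype.edist_eq]
      exact H.lipschitz (coe_mem_fullCone (hA hx)) (coe_mem_fullCone (hA hy))) 2
  rw [EuclideanSpace.euclideanHausdorffMeasure_eq_volume] at h1
  simpa using h1

end IsAlmostIsometric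

/-! ### Integrals over the sphere and the boundary, read in the chart -/

namespace IsAlmostIsometric

variable {b : OrthonormalBasis (Fin 4) ℝ E4} {h : S3 → ℝ} {M : ℝ≥0} {U : Set S3} {χ : S3 → ℝ}

variable (b h U χ) in
/-- A function on the sphere, read in the chart `flat b h` on `U`. -/
noncomputable def readIn : ℝ × E2 → ℝ :=
  Function.extend (fun x : U => flat b h x) (fun x : U => χ x) 0

lemma readIn_flat (H : IsAlmostIsometric b h M U) {x : S3} (hx : x ∈ U) :
    readIn b h U χ (flat b h x) = χ x := by
  have hinj : Function.Injective (fun x : U => flat b h x) := fun y z hyz =>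
    Subtype.ext (H.injOn y.2 z.2 hyz)
  exact hinj.extend_apply _ _ (⟨x, hx⟩ : U)

lemma readIn_eq_zero {ζ : ℝ × E2} (hζ : ζ ∉ flat b h '' U) : readIn b h U χ ζ = 0 := by
  rw [readIn, Function.extend_apply' _ _ _ (by rintro ⟨x, hx⟩; exact hζ ⟨x, x.2, hx⟩)]
  rfl

lemma readIn_eq_zero' (H : IsAlmostIsometric b h M U) {ζ : ℝ × E2}
    (hζ : ζ ∉ flat b h '' tsupport χ) : readIn b h U χ ζ = 0 := by
  by_cases h1 : ζ ∈ flat b h '' U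
  · obtain ⟨x, hx, rfl⟩ := h1
    rw [H.readIn_flat hx]
    exact image_eq_zero_of_notMem_tsupport fun h2 => hζ ⟨x, h2, rfl⟩
  · exact readIn_eq_zero h1

lemma readIn_nonneg (H : IsAlmostIsometric b h M U) (hχ : ∀ x, 0 ≤ χ x) (ζ : ℝ × E2) :
    0 ≤ readIn b h U χ ζ := by
  by_cases h1 : ζ ∈ flat b h '' U
  · obtain ⟨x, hx, rfl⟩ := h1
    rw [H.readIn_flat hx]
    exact hχ x
  · rw [readIn_eq_zero h1]

lemma isCompact_flat_tsupport (H : IsAlmostIsometric b h M U) :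
    IsCompact (flat b h '' tsupport χ) :=
  (isClosed_tsupport χ).isCompact.image (continuous_flat H.continuous)

/-- On the image of `U` continuity follows from openness of the chart. Off that image the function
vanishes on the complement of a compact set, which is a neighbourhood of the point. -/
lemma continuous_readIn (H : IsAlmostIsometric b h M U) (hχ : Continuous χ)
    (hs : tsupport χ ⊆ U) : Continuous (readIn b h U χ) := by
  rw [continuous_iff_continuousAt]
  intro ζ
  by_cases h1 : ζ ∈ flat b h '' U
  · obtain ⟨x, hx, rfl⟩ := h1
    have hO : ∀ V ∈ 𝓝 (χ x), ∀ᶠ ξ in 𝓝 (flat b h x), readIn b h U χ ξ ∈ V := by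
      intro V hV
      obtain ⟨V', hV'V, hV'o, hxV'⟩ := _root_.mem_nhds_iff.1 hV
      have h2 : IsOpen (flat b h '' (U ∩ χ ⁻¹' V')) :=
        H.isOpen_flat_image inter_subset_left (H.isOpen.inter (hV'o.preimage hχ))
      filter_upwards [h2.mem_nhds ⟨x, ⟨hx, hxV'⟩, rfl⟩]
      rintro _ ⟨y, hy, rfl⟩
      rw [H.readIn_flat hy.1]
      exact hV'V hy.2
    rw [ContinuousAt, H.readIn_flat hx]
    exact hO
  · have h2 : ζ ∉ flat b h '' tsupport χ := fun h3 => h1 (image_mono hs h3)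
    have h3 : readIn b h U χ =ᶠ[𝓝 ζ] fun _ => 0 := by
      filter_upwards [H.isCompact_flat_tsupport.isClosed.isOpen_compl.mem_nhds h2] with ξ hξ
      exact H.readIn_eq_zero' hξ
    exact continuousAt_const.congr h3.symm

lemma hasCompactSupport_readIn (H : IsAlmostIsometric b h M U) :
    HasCompactSupport (readIn b h U χ) :=
  HasCompactSupport.intro H.isCompact_flat_tsupport fun _ hζ => H.readIn_eq_zero' hζ

/-- Comparison of the mass near the boundary in the sphere and in the chart. -/
lemma shell_compare (H : IsAlmostIsometric b h M U) (hχ : Continuous χ) (hχ0 : ∀ x, 0 ≤ χ x)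
    (hs : tsupport χ ⊆ U) {c : ℝ} (hc : 0 ≤ c) :
    ∫ x, c * deriv ramp (c * h x) * χ x ∂vol3 ≤
        (M ^ 4 : ℝ≥0) * ∫ q, c * deriv ramp (c * -q.1) * readIn b h U χ q ∧
      ∫ q, c * deriv ramp (c * -q.1) * readIn b h U χ q ≤
        (M ^ 4 : ℝ≥0) * ∫ x, c * deriv ramp (c * h x) * χ x ∂vol3 := by
  have hFc : Continuous fun q : ℝ × E2 => c * deriv ramp (c * -q.1) * readIn b h U χ q := by
    have h1 := continuous_deriv_ramp
    have h2 := H.continuous_readIn hχ hs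
    fun_prop
  have hFi : Integrable fun q : ℝ × E2 => c * deriv ramp (c * -q.1) * readIn b h U χ q :=
    hFc.integrable_of_hasCompactSupport (hasCompactSupport_readIn H).mul_left
  have hcmp := integral_compare (μ := vol3) (ν := volume)
    (continuous_flat (b := b) H.continuous).measurable
    H.isOpen.measurableSet (fun A hA hAm => H.vol3_le hA hAm) (fun A hA hAm => H.le_vol3 hA hAm)
    (F := fun q : ℝ × E2 => c * deriv ramp (c * -q.1) * readIn b h U χ q)
    (fun q => mul_nonneg (mul_nonneg hc (deriv_ramp_nonneg _)) (H.readIn_nonneg hχ0 q)) hFi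
    (fun q hq => by rw [readIn_eq_zero hq, mul_zero])
  have h2 : ∫ x in U, c * deriv ramp (c * -(flat b h x).1) * readIn b h U χ (flat b h x) ∂vol3 =
      ∫ x, c * deriv ramp (c * h x) * χ x ∂vol3 := by
    rw [← setIntegral_eq_integral_of_forall_compl_eq_zero (s := U)
      (f := fun x => c * deriv ramp (c * h x) * χ x)]
    · refine setIntegral_congr_fun H.isOpen.measurableSet fun x hx => ?_
      rw [H.readIn_flat hx, flat, neg_neg]
    · intro x hx
      rw [image_eq_zero_of_notMem_tsupport fun h3 => hx (hs h3), mul_zero]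
  rw [h2] at hcmp
  exact hcmp.2

/-- Comparison of the area of the boundary with its area in the chart. -/
lemma area_compare (H : IsAlmostIsometric b h M U) (hχ : Continuous χ) (hχ0 : ∀ x, 0 ≤ χ x)
    (hs : tsupport χ ⊆ U) :
    IntegrableOn χ (U ∩ {x | h x = 0}) μHE[2] ∧
      ∫ x in U ∩ {x | h x = 0}, χ x ∂μHE[2] ≤ (M ^ 2 : ℝ≥0) * ∫ z, readIn b h U χ (0, z) ∧
      ∫ z, readIn b h U χ (0, z) ≤
        (M ^ 2 : ℝ≥0) * ∫ x in U ∩ {x | h x = 0}, χ x ∂μHE[2] := by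
  have hm : MeasurableSet (U ∩ {x | h x = 0}) :=
    H.isOpen.measurableSet.inter (isClosed_eq H.continuous continuous_const).measurableSet
  have hGc : Continuous fun z : E2 => readIn b h U χ (0, z) :=
    (H.continuous_readIn hχ hs).comp (by fun_prop)
  have hGs : HasCompactSupport fun z : E2 => readIn b h U χ (0, z) := by
    refine HasCompactSupport.intro
      ((H.isCompact_flat_tsupport (χ := χ)).image continuous_snd) fun z hz => ?_
    exact H.readIn_eq_zero' fun h1 => hz ⟨_, h1, rfl⟩
  have heq : ∀ x ∈ U ∩ {x | h x = 0}, readIn b h U χ (0, planar b x) = χ x := by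
    rintro x ⟨hx, hx0⟩
    have hx0' : h x = 0 := hx0
    rw [← H.readIn_flat (χ := χ) hx, flat, hx0', neg_zero]
  have h1 := integral_compare (μ := (μHE[2] : Measure S3)) (ν := (volume : Measure E2))
    (continuous_planar (b := b)).measurable hm
    (fun A hA _ => H.area_le (fun x hx => (hA hx).1) fun x hx => (hA hx).2)
    (fun A hA _ => H.le_area (fun x hx => (hA hx).1) fun x hx => (hA hx).2)
    (F := fun z : E2 => readIn b h U χ (0, z)) (fun z => H.readIn_nonneg hχ0 _)
    (hGc.integrable_of_hasCompactSupport hGs) (fun z hz => by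
      refine readIn_eq_zero ?_
      rintro ⟨x, hx, hxz⟩
      simp only [flat, Prod.mk.injEq, neg_eq_zero] at hxz
      exact hz ⟨x, ⟨hx, hxz.1⟩, hxz.2⟩)
  rw [setIntegral_congr_fun hm heq] at h1
  refine ⟨?_, h1.2⟩
  exact (integrableOn_congr_fun (fun x hx => heq x hx) hm).1 h1.1

/-- The planar projection of the sphere is compact. -/
lemma area_lt_top (H : IsAlmostIsometric b h M U) : μHE[2] (U ∩ {x | h x = 0}) < ⊤ := by
  refine (H.area_le inter_subset_left fun x hx => hx.2).trans_lt ?_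
  refine ENNReal.mul_lt_top ENNReal.coe_lt_top ?_
  have h1 : IsCompact (range (planar b)) := isCompact_range continuous_planar
  exact (measure_mono (image_subset_range _ _)).trans_lt h1.measure_lt_top

end IsAlmostIsometric

/-! ### The divergence theorem -/

lemma sdiv_smul {φ : S3 → ℝ} {v : S3 → E4} (hφ : ContMDiff (𝓡 3) 𝓘(ℝ, ℝ) ∞ φ)
    (hv : ContMDiff (𝓡 3) 𝓘(ℝ, E4) ∞ v) (x : S3) :
    sdiv (fun x => φ x • v x) x = φ x * sdiv v x + sderiv φ x (v x) := by
  set b := EuclideanSpace.basisFun (Fin 4) ℝ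
  rw [sdiv_eq_sum _ x b, sdiv_eq_sum _ x b, sderiv_smul hφ hv]
  have h1 : sderiv φ x (v x) = ∑ i, sderiv φ x (b i) * ⟪b i, v x⟫ := by
    conv_lhs => rw [← b.sum_repr (v x)]
    simp [b.repr_apply_apply, mul_comm]
  rw [h1, Finset.mul_sum, ← Finset.sum_add_distrib]
  refine Finset.sum_congr rfl fun i _ => ?_
  simp [inner_add_right, real_inner_smul_right]

lemma sdiv_eq_zero_of_notMem_tsupport {w : S3 → E4} {x : S3} (hx : x ∉ tsupport w) :
    sdiv w x = 0 := by
  have h1 : w ∘ dir =ᶠ[𝓝 (x : E4)] fun _ => 0 := by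
    have h2 : Tendsto dir (𝓝 (x : E4)) (𝓝 x) := by
      simpa [ContinuousAt] using continuousAt_dir (coe_S3_ne_zero x)
    filter_upwards [h2.eventually ((isClosed_tsupport w).isOpen_compl.mem_nhds hx)] with y hy
    exact image_eq_zero_of_notMem_tsupport (f := w) hy
  have h2 : sderiv w x = 0 := by
    rw [sderiv, h1.fderiv_eq]
    simp
  simp [sdiv, h2]

lemma sderiv_ramp {h : S3 → ℝ} (hh : ContMDiff (𝓡 3) 𝓘(ℝ, ℝ) ∞ h) (c : ℝ) (x : S3) (u : E4) :
    sderiv (fun y => ramp (c * h y)) x u = c * deriv ramp (c * h x) * ⟪sgrad h x, u⟫ := by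
  have h1 : HasFDerivAt (fun y => c * (h ∘ dir) y) (c • sderiv h x) (x : E4) :=
    (hasFDerivAt_sderiv hh x).const_mul c
  have h2 := (hasDerivAt_ramp (c * (h ∘ dir) (x : E4))).comp_hasFDerivAt (x : E4) h1
  have h3 : sderiv (fun y => ramp (c * h y)) x =
      deriv ramp (c * (h ∘ dir) (x : E4)) • c • sderiv h x := h2.fderiv
  rw [h3, inner_sgrad]
  simp
  ring

lemma contMDiff_ramp {h : S3 → ℝ} (hh : ContMDiff (𝓡 3) 𝓘(ℝ, ℝ) ∞ h) (c : ℝ) :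
    ContMDiff (𝓡 3) 𝓘(ℝ, ℝ) ∞ fun y => ramp (c * h y) :=
  contDiff_ramp.contMDiff.comp (contMDiff_const.mul hh)

/-- Integration by parts against a smoothed indicator function of `{0 ≤ h}`. -/
lemma integral_ramp_mul_sdiv {h : S3 → ℝ} (hh : ContMDiff (𝓡 3) 𝓘(ℝ, ℝ) ∞ h) {w : S3 → E4}
    (hw : ContMDiff (𝓡 3) 𝓘(ℝ, E4) ∞ w) (htan : ∀ x : S3, ⟪(x : E4), w x⟫ = 0) (c : ℝ) :
    ∫ x, ramp (c * h x) * sdiv w x ∂vol3 =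
      -∫ x, c * deriv ramp (c * h x) * ⟪sgrad h x, w x⟫ ∂vol3 := by
  have h1 := integral_sdiv ((contMDiff_ramp hh c).smul hw)
    (fun x => by simp only [Pi.smul_apply', real_inner_smul_right, htan, mul_zero])
  have h2 : ∀ x, sdiv (fun x => ramp (c * h x) • w x) x =
      ramp (c * h x) * sdiv w x + c * deriv ramp (c * h x) * ⟪sgrad h x, w x⟫ := fun x => by
    rw [sdiv_smul (contMDiff_ramp hh c) hw, sderiv_ramp hh]
  have h3 : ∫ x, sdiv (fun x => ramp (c * h x) • w x) x ∂vol3 = 0 := h1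
  simp_rw [h2] at h3
  have hcs := continuous_sdiv hw
  have hcg := continuous_sgrad hh
  have hcw := hw.continuous
  have hch := hh.continuous
  have hcr := contDiff_ramp.continuous
  have hcd := continuous_deriv_ramp
  have hi1 : Integrable (fun x => ramp (c * h x) * sdiv w x) vol3 := by
    rw [← integrableOn_univ]
    exact continuous_integrableOn (by fun_prop) _
  have hi2 : Integrable (fun x => c * deriv ramp (c * h x) * ⟪sgrad h x, w x⟫) vol3 := by
    rw [← integrableOn_univ]
    exact continuous_integrableOn (by fun_prop) _
  rw [integral_add hi1 hi2] at h3
  linarith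

/-- Dominated convergence: `ramp (c * h)` is 1 where `h ≥ 0` and is eventually 0 at each point with
`h < 0`. Membership in `K` is needed only where `f ≠ 0`, since `h` describes `K` only locally. -/
lemma tendsto_integral_ramp_mul {K : Set S3} (hK : MeasurableSet K) {h : S3 → ℝ}
    (hh : Continuous h) {f : S3 → ℝ} (hf : Continuous f)
    (hmem : ∀ x, f x ≠ 0 → (x ∈ K ↔ 0 ≤ h x)) :
    Tendsto (fun c => ∫ x, ramp (c * h x) * f x ∂vol3) atTop (𝓝 (∫ x in K, f x ∂vol3)) := by
  rw [← integral_indicator hK]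
  have hcr := contDiff_ramp.continuous
  refine tendsto_integral_filter_of_dominated_convergence (fun x => ‖f x‖) ?_ ?_ ?_ ?_
  · exact Eventually.of_forall fun c =>
      Continuous.aestronglyMeasurable (by fun_prop)
  · refine Eventually.of_forall fun c => ae_of_all _ fun x => ?_
    rw [norm_mul, Real.norm_of_nonneg (ramp_nonneg _)]
    exact mul_le_of_le_one_left (norm_nonneg _) (ramp_le_one _)
  · rw [← integrableOn_univ]
    exact continuous_integrableOn hf.norm _
  · refine ae_of_all _ fun x => ?_
    by_cases hx : f x = 0
    · by_cases hxK : x ∈ K <;> simp [hx, hxK]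
    by_cases h0 : 0 ≤ h x
    · rw [indicator_of_mem ((hmem x hx).2 h0)]
      refine tendsto_const_nhds.congr' ?_
      filter_upwards [eventually_ge_atTop 0] with c hc
      rw [ramp_of_nonneg (mul_nonneg hc h0), one_mul]
    · rw [indicator_of_notMem fun h1 => h0 ((hmem x hx).1 h1)]
      push Not at h0
      refine tendsto_const_nhds.congr' ?_
      filter_upwards [eventually_ge_atTop (-h x)⁻¹] with c hc
      rw [ramp_of_le, zero_mul]
      have h1 : 1 ≤ c * -h x := by
        rw [← inv_mul_cancel₀ (neg_pos.2 h0).ne']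
        gcongr
        linarith
      linarith

lemma IsAlmostIsometric.frontier_inter {K : Set S3} (hK : IsClosed K)
    {b : OrthonormalBasis (Fin 4) ℝ E4} {h : S3 → ℝ} {M : NNReal} {U : Set S3}
    (H : IsAlmostIsometric b h M U) (hd : ∀ q ∈ U, IsDefiningAt K q h) :
    frontier K ∩ U = U ∩ {x | h x = 0} := by
  ext q
  constructor
  · rintro ⟨h1, h2⟩
    exact ⟨h2, (hd q h2).eq_zero hK h1⟩
  · rintro ⟨h1, h2⟩
    have h2' : h q = 0 := h2
    refine ⟨⟨subset_closure ((hd q h1).mem_iff.self_of_nhds.2 h2'.ge), fun h3 => ?_⟩, h1⟩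
    -- If a zero of `h` were interior to `K`, openness of the chart would give points of `K` with
    -- small positive first coordinate `-h`, against `0 ≤ h` on `K`.
    have h4 : IsOpen (flat b h '' (U ∩ interior K)) :=
      H.isOpen_flat_image inter_subset_left (H.isOpen.inter isOpen_interior)
    have h5 : flat b h q ∈ flat b h '' (U ∩ interior K) := ⟨q, ⟨h1, h3⟩, rfl⟩
    have h6 : Tendsto (fun s : ℝ => ((s, (flat b h q).2) : ℝ × E2)) (𝓝[>] 0)
        (𝓝 (flat b h q)) := by
      have h7 : Continuous fun s : ℝ => ((s, (flat b h q).2) : ℝ × E2) := by fun_prop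
      have h8 := (h7.tendsto 0).mono_left (nhdsWithin_le_nhds (s := Ioi 0))
      have h9 : ((0 : ℝ), (flat b h q).2) = flat b h q := by simp [flat, h2']
      rwa [h9] at h8
    obtain ⟨s, ⟨y, ⟨hyU, hyK⟩, hys⟩, hs⟩ :=
      ((h6.eventually (h4.mem_nhds h5)).and self_mem_nhdsWithin).exists
    have h7 : -h y = s := congrArg Prod.fst hys
    have h8 := (hd y hyU).mem_iff.self_of_nhds.1 (interior_subset hyK)
    have h9 : (0 : ℝ) < s := hs
    linarith

/-- Replacing `A` by a quantity equal to it up to a factor `1 + ε` turns the constant `k` into `2k +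
1`: one factor 2 from `A ≤ 2 I`, and one more `ε I` from the difference. -/
lemma abs_add_mul_le {a ε k T A I : ℝ} (ha : |a| ≤ 1) (hε0 : 0 ≤ ε) (hε1 : ε ≤ 1) (hk : 0 ≤ k)
    (hI : 0 ≤ I) (hT : |T + a * A| ≤ k * ε * A) (h1 : A ≤ (1 + ε) * I) (h2 : I ≤ (1 + ε) * A) :
    |T + a * I| ≤ (2 * k + 1) * ε * I := by
  have hA2 : A ≤ 2 * I := by nlinarith
  have hAI : |A - I| ≤ ε * I := by
    rw [abs_le]
    constructor
    · rcases le_total A I with h | h <;> nlinarith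
    · linarith
  have h3 : |a * (A - I)| ≤ ε * I := by
    rw [abs_mul]
    exact (mul_le_of_le_one_left (abs_nonneg _) ha).trans hAI
  calc |T + a * I| = |(T + a * A) - a * (A - I)| := by ring_nf
    _ ≤ |T + a * A| + |a * (A - I)| := abs_sub _ _
    _ ≤ k * ε * A + ε * I := add_le_add hT h3
    _ ≤ k * ε * (2 * I) + ε * I := by gcongr
    _ = _ := by ring

/-! ### The flux through the boundary, locally and globally -/

section Flux

variable {K : Set S3} {v η : S3 → E4}

lemma abs_inner_le_one {x y : E4} (hx : ‖x‖ = 1) (hy : ‖y‖ = 1) : |⟪x, y⟫| ≤ 1 := by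
  simpa [hx, hy] using abs_real_inner_le_norm x y

lemma IsDomain3.continuousOn_flux (hK : IsDomain3 K) (hv : IsUnitField v)
    (hη : ∀ p ∈ frontier K, IsOutwardConormal K p (η p)) :
    ContinuousOn (fun x => ⟪v x, η x⟫) (frontier K) :=
  hv.smooth.continuous.continuousOn.inner (𝕜 := ℝ) (hK.continuousOn_conormal hη)

lemma IsDomain3.integrableOn_flux (hK : IsDomain3 K) (hv : IsUnitField v)
    (hη : ∀ p ∈ frontier K, IsOutwardConormal K p (η p)) {χ : S3 → ℝ} (hχ : Continuous χ)
    (hχ0 : ∀ x, 0 ≤ χ x) (hi : IntegrableOn χ (frontier K) μHE[2]) :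
    IntegrableOn (fun x => χ x * ⟪v x, η x⟫) (frontier K) μHE[2] := by
  have hm : MeasurableSet (frontier K) := isClosed_frontier.measurableSet
  refine Integrable.mono' hi
    ((hχ.continuousOn.mul (hK.continuousOn_flux hv hη)).aestronglyMeasurable hm) ?_
  filter_upwards [ae_restrict_mem hm] with x hx
  rw [norm_mul, Real.norm_of_nonneg (hχ0 x), Real.norm_eq_abs]
  exact mul_le_of_le_one_right (hχ0 x) (abs_inner_le_one (hv.unit x) (hη x hx).unit)

/-- The divergence theorem near a boundary point, up to a small error. -/
lemma IsDomain3.exists_flux_approx_frontier (hK : IsDomain3 K) (hv : IsUnitField v)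
    (hη : ∀ p ∈ frontier K, IsOutwardConormal K p (η p)) {ε : ℝ} (hε0 : 0 < ε) (hε1 : ε ≤ 1)
    {p : S3} (hp : p ∈ frontier K) :
    ∃ U : Set S3, IsOpen U ∧ p ∈ U ∧ μHE[2] (frontier K ∩ U) < ⊤ ∧
      ∀ χ : S3 → ℝ, ContMDiff (𝓡 3) 𝓘(ℝ, ℝ) ∞ χ → (∀ x, 0 ≤ χ x) → tsupport χ ⊆ U →
        |∫ x in K, sdiv (fun x => χ x • v x) x ∂vol3 -
            ∫ x in frontier K, χ x * ⟪v x, η x⟫ ∂μHE[2]| ≤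
          8 * ε * ∫ x in frontier K, χ x ∂μHE[2] := by
  have hKc : IsClosed K := hK.isCompact.isClosed
  have hm : MeasurableSet (frontier K) := isClosed_frontier.measurableSet
  obtain ⟨h, hd, hg⟩ := hK.exists_normalized hp (hη p hp)
  obtain ⟨b, hb0, hb1⟩ := exists_orthonormalBasis (norm_coe_S3 p) (hη p hp).unit (hη p hp).tangent
  set a := ⟪v p, η p⟫ with ha
  have ha1 : |a| ≤ 1 := abs_inner_le_one (hv.unit p) (hη p hp).unit
  have hN1 : ∀ᶠ q in 𝓝 p, |⟪sgrad h q, v q⟫ + a| < ε := by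
    have h1 : Continuous fun q => |⟪sgrad h q, v q⟫ + a| := by
      have := continuous_sgrad hd.smooth
      have := hv.smooth.continuous
      fun_prop
    refine h1.continuousAt.eventually_lt continuousAt_const ?_
    simpa [hg, ha, real_inner_comm] using hε0
  have hN2 : ∀ᶠ q in 𝓝 p, q ∈ frontier K → |⟪v q, η q⟫ - a| < ε := by
    have h1 : ContinuousWithinAt (fun q => |⟪v q, η q⟫ - a|) (frontier K) p :=
      ((hK.continuousOn_flux hv hη p hp).sub continuousWithinAt_const).abs
    rw [← eventually_nhdsWithin_iff]
    refine h1.eventually_lt continuousWithinAt_const ?_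
    simpa [ha] using hε0
  -- The distortion is small enough that both `M ^ 4` (volumes) and `M ^ 2` (areas) are at most `1 +
  -- ε`.
  set M : NNReal := ⟨1 + ε / 15, by positivity⟩ with hM
  have hMr : (M : ℝ) = 1 + ε / 15 := rfl
  have hM4 : (M : ℝ) ^ 4 ≤ 1 + ε := by
    have h1 : (M : ℝ) ^ 2 ≤ 1 + ε / 5 := by rw [hMr]; nlinarith
    calc (M : ℝ) ^ 4 = ((M : ℝ) ^ 2) ^ 2 := by ring
      _ ≤ (1 + ε / 5) ^ 2 := by gcongr
      _ ≤ 1 + ε := by nlinarith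
  have hM2 : (M : ℝ) ^ 2 ≤ 1 + ε := by rw [hMr]; nlinarith
  obtain ⟨U, hpU, hUN, H⟩ := exists_isAlmostIsometric (b := b) hd.smooth (hd.eq_zero hKc hp) hb0
    (by rw [hg, hb1]) (M := M) (by rw [← NNReal.coe_lt_coe, hMr]; push_cast; linarith)
    (hd.eventually.and (hN1.and hN2))
  have hfr : frontier K ∩ U = U ∩ {x | h x = 0} :=
    H.frontier_inter hKc fun q hq => (hUN hq).1
  refine ⟨U, H.isOpen, hpU, hfr ▸ H.area_lt_top, fun χ hχ hχ0 hs => ?_⟩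
  have hχU : ∀ x, χ x ≠ 0 → x ∈ U := fun x hx => hs (subset_tsupport χ hx)
  have hχc := hχ.continuous
  have hhc := hd.smooth.continuous
  have hvc := hv.smooth.continuous
  have hgc := continuous_sgrad hd.smooth
  have hrc := continuous_deriv_ramp
  have hw : ContMDiff (𝓡 3) 𝓘(ℝ, E4) ∞ fun x => χ x • v x := hχ.smul hv.smooth
  set L := ∫ x in K, sdiv (fun x => χ x • v x) x ∂vol3 with hL
  set M0 := ∫ x in frontier K, χ x ∂μHE[2] with hM0
  set R := IsAlmostIsometric.readIn b h U χ with hR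
  set G := ∫ z, R (0, z) with hG
  set A : ℝ → ℝ := fun c => ∫ x, c * deriv ramp (c * h x) * χ x ∂vol3 with hA
  set I : ℝ → ℝ := fun c => ∫ q, c * deriv ramp (c * -q.1) * R q with hI
  set T : ℝ → ℝ := fun c => ∫ x, c * deriv ramp (c * h x) * ⟪sgrad h x, χ x • v x⟫ ∂vol3 with hT
  have hiA : ∀ c, Integrable (fun x => c * deriv ramp (c * h x) * χ x) vol3 := fun c => by
    rw [← integrableOn_univ]
    exact continuous_integrableOn (by fun_prop) _
  have hiT : ∀ c, Integrable
      (fun x => c * deriv ramp (c * h x) * ⟪sgrad h x, χ x • v x⟫) vol3 := fun c => by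
    rw [← integrableOn_univ]
    exact continuous_integrableOn (by fun_prop) _
  -- By parts, `T c` is minus the integral of the divergence against the smoothed indicator of `K`.
  have hTL : Tendsto T atTop (𝓝 (-L)) := by
    have h1 : Tendsto (fun c => ∫ x, ramp (c * h x) * sdiv (fun x => χ x • v x) x ∂vol3) atTop
        (𝓝 L) := by
      refine tendsto_integral_ramp_mul hKc.measurableSet hhc (continuous_sdiv hw) fun x hx => ?_
      have h2 : x ∈ tsupport fun x => χ x • v x := by
        by_contra h3
        exact hx (sdiv_eq_zero_of_notMem_tsupport h3)
      exact (hUN (hs (tsupport_smul_subset_left χ v h2))).1.mem_iff.self_of_nhds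
    refine h1.neg.congr fun c => ?_
    rw [integral_ramp_mul_sdiv hd.smooth hw, neg_neg]
    intro x
    rw [real_inner_smul_right, hv.tangent, mul_zero]
  have hIG : Tendsto I atTop (𝓝 G) :=
    tendsto_integral_ramp (H.continuous_readIn hχc hs) H.hasCompactSupport_readIn
  have hG0 : 0 ≤ G := integral_nonneg fun z => H.readIn_nonneg hχ0 _
  -- On the support of `χ` the factor `⟪sgrad h, v⟫` is within `ε` of `-a`, so `T c` is close to `-a
  -- * A c`. Only `I c` has a limit known beforehand, so `A c` is eliminated before `c → ∞`.
  have hTI : ∀ c, 0 ≤ c → |T c + a * I c| ≤ (2 * 1 + 1) * ε * I c := by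
    intro c hc
    have hI0 : 0 ≤ I c := integral_nonneg fun q =>
      mul_nonneg (mul_nonneg hc (deriv_ramp_nonneg _)) (H.readIn_nonneg hχ0 q)
    have hA0 : 0 ≤ A c := integral_nonneg fun x =>
      mul_nonneg (mul_nonneg hc (deriv_ramp_nonneg _)) (hχ0 x)
    obtain ⟨h1, h2⟩ := H.shell_compare hχc hχ0 hs hc
    push_cast at h1 h2
    refine abs_add_mul_le ha1 hε0.le hε1 zero_le_one hI0 (A := A c) ?_
      (h1.trans (by gcongr)) (h2.trans (mul_le_mul_of_nonneg_right hM4 hA0))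
    have h3 : T c + a * A c = ∫ x, (c * deriv ramp (c * h x) * ⟪sgrad h x, χ x • v x⟫ +
        a * (c * deriv ramp (c * h x) * χ x)) ∂vol3 := by
      rw [integral_add (hiT c) ((hiA c).const_mul a), integral_const_mul]
    rw [h3, one_mul, hA, ← integral_const_mul, ← Real.norm_eq_abs]
    refine norm_integral_le_of_norm_le ((hiA c).const_mul ε) (ae_of_all _ fun x => ?_)
    by_cases hx : χ x = 0
    · simp [hx]
    have h4 := (hUN (hχU x hx)).2.1
    have h5 : 0 ≤ c * deriv ramp (c * h x) * χ x :=
      mul_nonneg (mul_nonneg hc (deriv_ramp_nonneg _)) (hχ0 x)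
    have h6 : c * deriv ramp (c * h x) * ⟪sgrad h x, χ x • v x⟫ +
        a * (c * deriv ramp (c * h x) * χ x) =
        (⟪sgrad h x, v x⟫ + a) * (c * deriv ramp (c * h x) * χ x) := by
      rw [real_inner_smul_right]; ring
    rw [h6, Real.norm_eq_abs, abs_mul, abs_of_nonneg h5]
    exact mul_le_mul_of_nonneg_right h4.le h5
  have hLG : |-L + a * G| ≤ (2 * 1 + 1) * ε * G := by
    refine le_of_tendsto_of_tendsto (hTL.add (hIG.const_mul a)).abs (hIG.const_mul _) ?_
    filter_upwards [eventually_ge_atTop 0] with c hc using hTI c hc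
  obtain ⟨h1, h2, h3⟩ := H.area_compare hχc hχ0 hs
  rw [← hfr] at h1 h2 h3
  have hz : ∀ x ∈ frontier K \ (frontier K ∩ U), χ x = 0 := fun x hx => by
    by_contra h4
    exact hx.2 ⟨hx.1, hχU x h4⟩
  rw [← setIntegral_eq_of_subset_of_forall_sdiff_eq_zero hm inter_subset_left hz] at h2 h3
  have hi : IntegrableOn χ (frontier K) μHE[2] := h1.of_forall_sdiff_eq_zero hm hz
  have hM00 : 0 ≤ M0 := integral_nonneg fun x => hχ0 x
  push_cast at h2 h3
  -- The second transfer, from the chart to the actual area, raises the constant from 3 to 7. The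
  -- oscillation of `⟪v, η⟫` in `hF` adds the last 1 of the final 8.
  have hLM : |-L + a * M0| ≤ (2 * (2 * 1 + 1) + 1) * ε * M0 :=
    abs_add_mul_le ha1 hε0.le hε1 (by norm_num) hM00 hLG
      (h3.trans (mul_le_mul_of_nonneg_right hM2 hM00))
      (h2.trans (mul_le_mul_of_nonneg_right hM2 hG0))
  have hF : |∫ x in frontier K, χ x * ⟪v x, η x⟫ ∂μHE[2] - a * M0| ≤ ε * M0 := by
    rw [hM0, ← integral_const_mul, ← integral_const_mul,
      ← integral_sub (hK.integrableOn_flux hv hη hχc hχ0 hi) (hi.const_mul a), ← Real.norm_eq_abs]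
    refine norm_integral_le_of_norm_le (hi.const_mul ε) ?_
    filter_upwards [ae_restrict_mem hm] with x hx
    by_cases hx0 : χ x = 0
    · simp [hx0]
    have h4 := (hUN (hχU x hx0)).2.2 hx
    have h5 : χ x * ⟪v x, η x⟫ - a * χ x = (⟪v x, η x⟫ - a) * χ x := by ring
    rw [h5, Real.norm_eq_abs, abs_mul, abs_of_nonneg (hχ0 x)]
    exact mul_le_mul_of_nonneg_right h4.le (hχ0 x)
  rw [abs_le] at hLM hF ⊢
  constructor <;> linarith

/-- The divergence theorem near an arbitrary point, up to a small error. -/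
lemma IsDomain3.exists_flux_approx (hK : IsDomain3 K) (hv : IsUnitField v)
    (hη : ∀ p ∈ frontier K, IsOutwardConormal K p (η p)) {ε : ℝ} (hε0 : 0 < ε) (hε1 : ε ≤ 1)
    (p : S3) :
    ∃ U : Set S3, IsOpen U ∧ p ∈ U ∧ μHE[2] (frontier K ∩ U) < ⊤ ∧
      ∀ χ : S3 → ℝ, ContMDiff (𝓡 3) 𝓘(ℝ, ℝ) ∞ χ → (∀ x, 0 ≤ χ x) → tsupport χ ⊆ U →
        |∫ x in K, sdiv (fun x => χ x • v x) x ∂vol3 -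
            ∫ x in frontier K, χ x * ⟪v x, η x⟫ ∂μHE[2]| ≤
          8 * ε * ∫ x in frontier K, χ x ∂μHE[2] := by
  by_cases hp : p ∈ frontier K
  · exact hK.exists_flux_approx_frontier hv hη hε0 hε1 hp
  have hKc : IsClosed K := hK.isCompact.isClosed
  have hfr : ∀ U : Set S3, Disjoint (frontier K) U → ∀ χ : S3 → ℝ, tsupport χ ⊆ U →
      ∀ x ∈ frontier K, χ x = 0 := fun U hU χ hs x hx =>
    image_eq_zero_of_notMem_tsupport fun h1 => hU.le_bot ⟨hx, hs h1⟩
  -- Off the frontier both integrals vanish: in the interior the field `χ v` is supported in `K` and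
  -- its divergence integrates to zero over the sphere; outside there is nothing to integrate.
  suffices ∃ U : Set S3, IsOpen U ∧ p ∈ U ∧ Disjoint (frontier K) U ∧
      ∀ χ : S3 → ℝ, ContMDiff (𝓡 3) 𝓘(ℝ, ℝ) ∞ χ → tsupport χ ⊆ U →
        ∫ x in K, sdiv (fun x => χ x • v x) x ∂vol3 = 0 by
    obtain ⟨U, hUo, hpU, hd, hU⟩ := this
    refine ⟨U, hUo, hpU, by simp [hd.inter_eq], fun χ hχ _ hs => ?_⟩
    have hz := hfr U hd χ hs
    rw [hU χ hχ hs, setIntegral_eq_zero_of_forall_eq_zero hz,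
      setIntegral_eq_zero_of_forall_eq_zero fun x hx => by rw [hz x hx, zero_mul]]
    simp
  have hsd : ∀ (χ : S3 → ℝ) (x : S3), x ∉ tsupport χ → sdiv (fun x => χ x • v x) x = 0 :=
    fun χ x hx => sdiv_eq_zero_of_notMem_tsupport fun h1 =>
      hx (tsupport_smul_subset_left χ v h1)
  by_cases hpK : p ∈ K
  · refine ⟨interior K, isOpen_interior, ?_, disjoint_interior_frontier.symm, fun χ hχ hs => ?_⟩
    · by_contra h1
      exact hp ⟨subset_closure hpK, h1⟩
    · rw [setIntegral_eq_integral_of_forall_compl_eq_zero fun x hx =>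
        hsd χ x fun h1 => hx (interior_subset (hs h1))]
      refine integral_sdiv (hχ.smul hv.smooth) fun x => ?_
      simp only [real_inner_smul_right, hv.tangent, mul_zero]
  · refine ⟨Kᶜ, hKc.isOpen_compl, hpK, ?_, fun χ hχ hs => ?_⟩
    · exact disjoint_compl_right.mono_left hKc.frontier_subset
    · exact setIntegral_eq_zero_of_forall_eq_zero fun x hx => hsd χ x fun h1 => hs h1 hx

/-- The gradients of a partition of unity sum to zero, so the product rule leaves only the
divergence. -/
lemma sum_sdiv_smul {ι : Type*} [Fintype ι] {χ : ι → S3 → ℝ}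
    (hχ : ∀ i, ContMDiff (𝓡 3) 𝓘(ℝ, ℝ) ∞ (χ i)) (h1 : ∀ x, ∑ i, χ i x = 1)
    (hv : ContMDiff (𝓡 3) 𝓘(ℝ, E4) ∞ v) (x : S3) :
    ∑ i, sdiv (fun x => χ i x • v x) x = sdiv v x := by
  have h2 : ∑ i, sderiv (χ i) x = 0 := by
    have h3 : HasFDerivAt (fun y => ∑ i, (χ i ∘ dir) y) (∑ i, sderiv (χ i) x) (x : E4) :=
      HasFDerivAt.fun_sum fun i _ => hasFDerivAt_sderiv (hχ i) x
    simp only [Function.comp_apply, h1] at h3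
    exact h3.unique (hasFDerivAt_const _ _)
  simp_rw [sdiv_smul (hχ _) hv]
  rw [Finset.sum_add_distrib, ← Finset.sum_mul, h1, one_mul, ← sum_apply, h2]
  simp

lemma IsDomain3.area_frontier_lt_top (hK : IsDomain3 K) (hv : IsUnitField v)
    (hη : ∀ p ∈ frontier K, IsOutwardConormal K p (η p)) :
    μHE[2] (frontier K) < ⊤ := by
  -- Only the local finiteness of the area is used, so any admissible error, here 1, will do.
  choose U hUo hpU hUa _ using hK.exists_flux_approx hv hη one_pos le_rfl
  obtain ⟨s, hs⟩ := isCompact_univ.elim_nhds_subcover U fun x _ => (hUo x).mem_nhds (hpU x)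
  have h1 : frontier K ⊆ ⋃ i ∈ s, frontier K ∩ U i := fun x hx => by
    obtain ⟨i, hi, hxi⟩ := mem_iUnion₂.1 (hs.2 (mem_univ x))
    exact mem_iUnion₂.2 ⟨i, hi, hx, hxi⟩
  exact (measure_mono h1).trans_lt
    (measure_biUnion_lt_top s.finite_toSet fun i _ => hUa i)

/-- The divergence theorem on a smooth domain of the sphere. -/
theorem IsDomain3.integral_sdiv_eq_flux (hK : IsDomain3 K) (hv : IsUnitField v)
    (hη : ∀ p ∈ frontier K, IsOutwardConormal K p (η p)) :
    ∫ x in K, sdiv v x ∂vol3 = ∫ x in frontier K, ⟪v x, η x⟫ ∂μHE[2] := by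
  have hfin := hK.area_frontier_lt_top hv hη
  have hint : ∀ χ : S3 → ℝ, Continuous χ → (∀ x, 0 ≤ χ x) → (∀ x, χ x ≤ 1) →
      IntegrableOn χ (frontier K) μHE[2] := by
    intro χ hχ h0 h1
    refine Integrable.mono' (integrableOn_const (C := (1 : ℝ)) hfin.ne)
      hχ.aestronglyMeasurable (ae_of_all _ fun x => ?_)
    rw [Real.norm_of_nonneg (h0 x)]
    exact h1 x
  have key : ∀ ε : ℝ, 0 < ε → ε ≤ 1 →
      |∫ x in K, sdiv v x ∂vol3 - ∫ x in frontier K, ⟪v x, η x⟫ ∂μHE[2]| ≤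
        8 * ε * (μHE[2] : Measure S3).real (frontier K) := by
    intro ε hε0 hε1
    choose U hUo hpU _ hU using hK.exists_flux_approx hv hη hε0 hε1
    obtain ⟨s, hs⟩ := isCompact_univ.elim_nhds_subcover U fun x _ => (hUo x).mem_nhds (hpU x)
    obtain ⟨f, hf⟩ := SmoothPartitionOfUnity.exists_isSubordinate (𝓡 3) (s := (univ : Set S3))
      isClosed_univ (fun i : s => U i) (fun i => hUo i) (fun x hx => by
        obtain ⟨i, hi, hxi⟩ := mem_iUnion₂.1 (hs.2 hx)
        exact mem_iUnion.2 ⟨⟨i, hi⟩, hxi⟩)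
    have hsum : ∀ x, ∑ i, f i x = 1 := fun x => by
      rw [← finsum_eq_sum_of_fintype]
      exact f.sum_eq_one (mem_univ x)
    have hsm : ∀ i, ContMDiff (𝓡 3) 𝓘(ℝ, ℝ) ∞ (f i) := fun i => (f i).contMDiff
    have hi : ∀ i, IntegrableOn (f i) (frontier K) μHE[2] := fun i =>
      hint _ (hsm i).continuous (f.nonneg i) (f.le_one i)
    have h1 : ∫ x in K, sdiv v x ∂vol3 =
        ∑ i, ∫ x in K, sdiv (fun x => f i x • v x) x ∂vol3 := by
      have hw : ∀ i, ContMDiff (𝓡 3) 𝓘(ℝ, E4) ∞ fun x => f i x • v x := fun i =>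
        (hsm i).smul hv.smooth
      rw [← integral_finsetSum _ fun i _ => continuous_integrableOn (continuous_sdiv (hw i)) K]
      exact integral_congr_ae (ae_of_all _ fun x => (sum_sdiv_smul hsm hsum hv.smooth x).symm)
    have h2 : ∫ x in frontier K, ⟪v x, η x⟫ ∂μHE[2] =
        ∑ i, ∫ x in frontier K, f i x * ⟪v x, η x⟫ ∂μHE[2] := by
      rw [← integral_finsetSum _ fun i _ =>
        hK.integrableOn_flux hv hη (hsm i).continuous (f.nonneg i) (hi i)]
      simp_rw [← Finset.sum_mul, hsum, one_mul]
    have h3 : (μHE[2] : Measure S3).real (frontier K) = ∑ i, ∫ x in frontier K, f i x ∂μHE[2] := by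
      rw [← integral_finsetSum _ fun i _ => hi i]
      simp_rw [hsum]
      simp
    rw [h1, h2, h3, ← Finset.sum_sub_distrib, Finset.mul_sum]
    exact (Finset.abs_sum_le_sum_abs _ _).trans
      (Finset.sum_le_sum fun i _ => hU i _ (hsm i) (f.nonneg i) (hf i))
  -- The partition of unity depends on `ε`, but the summed error involves only the fixed total area.
  have hlim : Tendsto (fun ε : ℝ => 8 * ε * (μHE[2] : Measure S3).real (frontier K)) (𝓝[>] 0)
      (𝓝 0) := by
    have h1 : Continuous fun ε : ℝ => 8 * ε * (μHE[2] : Measure S3).real (frontier K) := by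
      fun_prop
    have h2 := (h1.tendsto 0).mono_left (nhdsWithin_le_nhds (s := Ioi 0))
    simpa using h2
  have h0 := ge_of_tendsto hlim (by
    filter_upwards [Ioc_mem_nhdsGT (zero_lt_one (α := ℝ))] with ε hε using key ε hε.1 hε.2)
  exact sub_eq_zero.1 (abs_nonpos_iff.1 h0)

end Flux

end SphereField

theorem theorem1p4 (K : Set SphereField.S3) (hK : SphereField.IsDomain3 K)
    (v : SphereField.S3 → SphereField.E4) (hv : SphereField.IsUnitField v)
    (t : ℝ) (ht : 0 < t)
    (hdiff : SphereField.IsDiffeoOntoSphere (SphereField.flowMap v t) (√(1 + t ^ 2)))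
    (η : SphereField.S3 → SphereField.E4)
    (hη : ∀ p ∈ frontier K, SphereField.IsOutwardConormal K p (η p))
    (hflux : ∫ p in frontier K, ⟪v p, η p⟫ ∂μHE[2] = 0)
    (hprop : SphereField.radiusVol (√(1 + t ^ 2)) (SphereField.flowMap v t '' K) /
        SphereField.radiusVol (√(1 + t ^ 2)) (Metric.sphere 0 (√(1 + t ^ 2))) ≥
      SphereField.vol3.real K / SphereField.vol3.real Set.univ)
    (H : SphereField.S3 → SphereField.E4) (hH : SphereField.IsHopfField H) :
    SphereField.fieldVol K v ≥ SphereField.fieldVol K H ∧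
      SphereField.fieldVol K H = 2 * SphereField.vol3.real K ∧
      SphereField.energy K v ≥ SphereField.energy K H :=
  SphereField.main_of_integral_sdiv hK.isCompact hv ht hdiff
    ((hK.integral_sdiv_eq_flux hv hη).trans hflux) hprop hH
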